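/- Let $\mathcal N$ be a von Neumann algebra on a Hilbert space $H$, let $G$ be a discrete group, and let $\alpha : G\to\operatorname{Aut}(\mathcal N)$ be an action of $G$ on $\mathcal N$ by $*$-automorphisms. Let $\mathcal M=\mathcal N\rtimes_\alpha G$ be the crossed product, i.e. the von Neumann algebra on $\ell^2(G,H)$ generated by the operators $(\pi(x)\xi)(g)=\alpha_{g^{-1}}(x)\,\xi(g)$, $x\in\mathcal N$, and $(\lambda_h\xi)(g)=\xi(h^{-1}g)$, $h\in G$; identify $\mathcal N$ and its center $\mathcal Z(\mathcal N)$ with their images under $\pi$. An automorphism $\theta$ of a von Neumann algebra $\mathcal A$ is properly outer if there is no nonzero central projection $z\in\mathcal A$ such that $\theta|_{\mathcal A z}$ is inner, i.e. such that for some $u\in\mathcal A$ with $u^*u=uu^*=z$ one has $\theta(y)=uyu^*$ for all $y\in\mathcal Az$. A group acts by properly outer automorphisms if each group element other than the identity acts by a properly outer automorphism. A triple $(\mathcal M,\mathcal N,\mathcal D)$ of von Neumann algebras is a Cartan triple if 1. $\mathcal D$ is an abelian von Neumann subalgebra of $\mathcal M$ that is regular in $\mathcal M$, i.e. the linear span of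 the partial isometries $v\in\mathcal M$ with $v^*\mathcal Dv\cup v\mathcal Dv^*\subseteq\mathcal D$ is weak-$*$ dense in $\mathcal M$; 2. $\mathcal N=\{m\in\mathcal M : dm=md\text{ for all }d\in\mathcal D\}$; 3. there is a faithful normal conditional expectation $E:\mathcal M\to\mathcal N$. Suppose that $G$ acts on $\mathcal N$ by properly outer automorphisms. Then $(\mathcal N\rtimes_\alpha G,\ \mathcal N,\ \mathcal Z(\mathcal N))$ is a Cartan triple if and only if the restricted action of $G$ on the center $\mathcal Z(\mathcal N)$ is by properly outer automorphisms, i.e. $\alpha_g|_{\mathcal Z(\mathcal N)}$ is a properly outer automorphism of $\mathcal Z(\mathcal N)$ for every $g\ne e$. -/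

import Mathlib

open scoped InnerProductSpace

noncomputable section

namespace CartanTriple

universe u v

/-! ### Von Neumann algebras and Cartan triples -/

section VonNeumann

variable {K : Type u} [NormedAddCommGroup K] [InnerProductSpace ℂ K] [CompleteSpace K]

/-- A unital `*`-subalgebra of `B(K)` is a von Neumann algebra if it is its own double commutant. -/
def IsVonNeumann (M : StarSubalgebra ℂ (K →L[ℂ] K)) : Prop :=
  Set.centralizer (Set.centralizer (M : Set (K →L[ℂ] K))) = M

/-- The von Neumann algebra generated by a set of operators: the double commutant of the
set together with its adjoints. -/
def generatedVN (S : Set (K →L[ℂ] K)) : StarSubalgebra ℂ (K →L[ℂ] K) :=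
  StarSubalgebra.centralizer ℂ (StarSubalgebra.centralizer ℂ S : Set (K →L[ℂ] K))

/-- The weak-`*` (ultraweak) topology of `B(K)`: the coarsest topology that makes all the
functionals `T ↦ ∑ₙ ⟪ξₙ, T ηₙ⟫` continuous, where `ξ` and `η` are square-summable sequences in `K`.
On a von Neumann subalgebra of `B(K)` it induces the weak-`*` topology of that algebra. -/
@[reducible]
def ultraweakTopology (K : Type u) [NormedAddCommGroup K] [InnerProductSpace ℂ K] : TopologicalSpace (K →L[ℂ] K) :=
  ⨅ (ξ : lp (fun _ : ℕ => K) 2) (η : lp (fun _ : ℕ => K) 2),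
    TopologicalSpace.induced (fun T : K →L[ℂ] K => ∑' n, ⟪ξ n, T (η n)⟫_ℂ) inferInstance

/-- The groupoid normalizer of `L` in `M`: the partial isometries `v ∈ M` such that
`v* L v` and `v L v*` are contained in `L`. -/
def groupoidNormalizer (M L : StarSubalgebra ℂ (K →L[ℂ] K)) : Set (K →L[ℂ] K) :=
  {v | v ∈ M ∧ v * star v * v = v ∧ ∀ x ∈ L, star v * x * v ∈ L ∧ v * x * star v ∈ L}

/-- `L` is regular in `M`: the linear span of the groupoid normalizer is weak-`*` dense in `M`. -/
def IsRegular (M L : StarSubalgebra ℂ (K →L[ℂ] K)) : Prop :=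
  (M : Set (K →L[ℂ] K)) ⊆
    @closure _ (ultraweakTopology K) (Submodule.span ℂ (groupoidNormalizer M L) : Set (K →L[ℂ] K))

/-- `E : M → N` is a faithful normal conditional expectation. The orders on `M` and `N` are
inherited from the Loewner order of `B(K)`; normality is preservation of suprema of directed sets. -/
structure IsFaithfulNormalCondExp {M N : StarSubalgebra ℂ (K →L[ℂ] K)} (hNM : N ≤ M)
    (E : M →ₗ[ℂ] N) : Prop where
  apply_of_mem : ∀ a : N, E (StarSubalgebra.inclusion hNM a) = a
  bimodule : ∀ (a b : N) (x : M),
    E (StarSubalgebra.inclusion hNM a * x * StarSubalgebra.inclusion hNM b) = a * E x * b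
  positive : ∀ x : M, 0 ≤ (x : K →L[ℂ] K) → 0 ≤ (E x : K →L[ℂ] K)
  faithful : ∀ x : M, E (star x * x) = 0 → x = 0
  normal : ScottContinuous E

/-- `(M, N, D)` is a Cartan triple: three von Neumann algebras such that `D` is an abelian regular
subalgebra of `M`, `N` is the relative commutant of `D` in `M`, and there is a faithful normal
conditional expectation of `M` onto `N`. -/
structure IsCartanTriple (M N D : StarSubalgebra ℂ (K →L[ℂ] K)) : Prop where
  vonNeumann_M : IsVonNeumann M
  vonNeumann_N : IsVonNeumann N
  vonNeumann_D : IsVonNeumann D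
  le : D ≤ M
  abelian : ∀ x ∈ D, ∀ y ∈ D, x * y = y * x
  regular : IsRegular M D
  relativeCommutant : ∀ m : K →L[ℂ] K, m ∈ N ↔ m ∈ M ∧ ∀ x ∈ D, x * m = m * x
  condExp : ∃ (hNM : N ≤ M) (E : M →ₗ[ℂ] N), IsFaithfulNormalCondExp hNM E

end VonNeumann

/-! ### The center and properly outer automorphisms -/

section Automorphisms

variable {A : Type u} [Ring A] [StarRing A] [Algebra ℂ A] [StarModule ℂ A]

/-- A `*`-automorphism `θ` of `A` is properly outer if there is no nonzero central projection `z`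
such that the restriction of `θ` to `A z` is inner, i.e. is an automorphism of `A z` of the form
`y ↦ u y u*` with `u` a unitary of `A z`. (The last condition with `x = 1` gives `θ z = z`, and the
first two give `u = u z = z u`.) -/
def IsProperlyOuter (θ : A ≃⋆ₐ[ℂ] A) : Prop :=
  ∀ z : A, IsStarProjection z → z ∈ Set.center A →
    (∃ u : A, star u * u = z ∧ u * star u = z ∧ ∀ x : A, θ (x * z) = u * (x * z) * star u) → z = 0

variable (A) in
/-- The center of `A`. -/
def center : StarSubalgebra ℂ A where
  toSubalgebra := Subalgebra.center ℂ A
  star_mem' := Set.star_mem_center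

theorem map_mem_center (θ : A ≃⋆ₐ[ℂ] A) {x : A} (hx : x ∈ center A) : θ x ∈ center A := by
  change θ x ∈ Subalgebra.center ℂ A
  rw [Subalgebra.mem_center_iff]
  intro b
  have h := (Subalgebra.mem_center_iff (R := ℂ)).1 (show x ∈ Subalgebra.center ℂ A from hx)
    (θ.symm b)
  simpa using congrArg θ h

/-- The restriction of a `*`-automorphism of `A` to the center of `A`. -/
def restrictCenter (θ : A ≃⋆ₐ[ℂ] A) : center A ≃⋆ₐ[ℂ] center A where
  toFun x := ⟨θ x, map_mem_center θ x.2⟩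
  invFun x := ⟨θ.symm x, map_mem_center θ.symm x.2⟩
  left_inv x := Subtype.ext (θ.symm_apply_apply x)
  right_inv x := Subtype.ext (θ.apply_symm_apply x)
  map_mul' x y := Subtype.ext (map_mul θ (x : A) y)
  map_add' x y := Subtype.ext (map_add θ (x : A) y)
  map_star' x := Subtype.ext (map_star θ (x : A))
  map_smul' c x := Subtype.ext (map_smul θ c (x : A))

end Automorphisms

/-! ### The crossed product by a discrete group -/

section CrossedProduct

variable {H : Type u} [NormedAddCommGroup H] [InnerProductSpace ℂ H] {G : Type v}

/-- The Hilbert space `ℓ²(G, H)`. -/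
abbrev ell2 (G : Type v) (H : Type u) [NormedAddCommGroup H] : Type (max v u) :=
  lp (fun _ : G => H) 2

theorem norm_aut_apply_le [CompleteSpace H] (N : VonNeumannAlgebra H)
    (θ : N.toStarSubalgebra ≃⋆ₐ[ℂ] N.toStarSubalgebra) (x : N.toStarSubalgebra) :
    ‖(θ x : H →L[ℂ] H)‖ ≤ ‖(x : H →L[ℂ] H)‖ := by
  have hc : IsClosed (N.toStarSubalgebra : Set (H →L[ℂ] H)) := by
    have h := N.centralizer_centralizer
    rw [VonNeumannAlgebra.coe_toStarSubalgebra, ← h]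
    exact Set.isClosed_centralizer _
  let _ : CStarAlgebra N.toStarSubalgebra := StarSubalgebra.cstarAlgebra _ (h_closed := hc)
  exact NonUnitalStarAlgHom.norm_apply_le θ x

theorem memℓp_translation {H : Type u} [NormedAddCommGroup H] {G : Type v} [Group G]
    (h : G) (ξ : ell2 G H) : Memℓp (fun g => ξ (h⁻¹ * g)) 2 := by
  have hp : 0 < (2 : ENNReal).toReal := by norm_num
  exact (memℓp_gen_iff hp).2 <|
    ((Equiv.mulLeft h⁻¹).summable_iff (f := fun g => ‖ξ g‖ ^ (2 : ENNReal).toReal)).2 <|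
      (memℓp_gen_iff hp).1 (lp.memℓp ξ)

/-- A bounded family of operators on `H` maps `ℓ²(G, H)` to itself. -/
theorem norm_diagonal_le {T : G → H →L[ℂ] H} {C : ℝ} (hT : ∀ g, ‖T g‖ ≤ C) (ξ : ell2 G H) (g : G) :
    ‖T g (ξ g)‖ ≤ ‖(C • ξ : ell2 G H) g‖ := by
  rw [lp.coeFn_smul, Pi.smul_apply, norm_smul, Real.norm_eq_abs]
  exact (T g).le_of_opNorm_le ((hT g).trans (le_abs_self C)) _

theorem memℓp_diagonal {T : G → H →L[ℂ] H} {C : ℝ} (hT : ∀ g, ‖T g‖ ≤ C) (ξ : ell2 G H) :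
    Memℓp (fun g => T g (ξ g)) 2 :=
  (lp.memℓp (C • ξ)).mono' (norm_diagonal_le hT ξ)

/-- The diagonal operator `(ξ_g)_g ↦ (T_g ξ_g)_g` on `ℓ²(G, H)`, for a bounded family of
operators `T_g` on `H`. -/
def diagonal (T : G → H →L[ℂ] H) (C : ℝ) (hT : ∀ g, ‖T g‖ ≤ C) : ell2 G H →L[ℂ] ell2 G H :=
  LinearMap.mkContinuous
    { toFun := fun ξ => (⟨fun g => T g (ξ g), memℓp_diagonal hT ξ⟩ : ell2 G H)
      map_add' := fun ξ η => lp.ext <| funext fun g => map_add (T g) (ξ g) (η g)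
      map_smul' := fun c ξ => lp.ext <| funext fun g => map_smul (T g) c (ξ g) }
    |C| fun ξ => by
      have h := lp.norm_mono (p := 2) (by norm_num)
        (x := (⟨fun g => T g (ξ g), memℓp_diagonal hT ξ⟩ : ell2 G H)) (y := C • ξ)
        (norm_diagonal_le hT ξ)
      rwa [norm_smul, Real.norm_eq_abs] at h

@[simp]
theorem diagonal_apply (T : G → H →L[ℂ] H) (C : ℝ) (hT : ∀ g, ‖T g‖ ≤ C) (ξ : ell2 G H) (g : G) :
    diagonal T C hT ξ g = T g (ξ g) := rfl

variable [Group G]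

/-- The operator of left translation by `h` on `ℓ²(G, H)`: `(λ_h ξ)(g) = ξ(h⁻¹ g)`. -/
def translation (h : G) : ell2 G H →L[ℂ] ell2 G H :=
  LinearMap.mkContinuous
    { toFun := fun ξ => (⟨fun g => ξ (h⁻¹ * g), memℓp_translation h ξ⟩ : ell2 G H)
      map_add' := fun ξ η => rfl
      map_smul' := fun c ξ => rfl }
    1 fun ξ => by
      rw [one_mul, lp.norm_eq_tsum_rpow (by norm_num), lp.norm_eq_tsum_rpow (by norm_num)]
      exact le_of_eq <| congrArg (fun t : ℝ => t ^ (1 / (2 : ENNReal).toReal)) <|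
        (Equiv.mulLeft h⁻¹).tsum_eq fun g => ‖ξ g‖ ^ (2 : ENNReal).toReal

@[simp]
theorem translation_apply (h : G) (ξ : ell2 G H) (g : G) : translation h ξ g = ξ (h⁻¹ * g) := rfl

variable [CompleteSpace H] (N : VonNeumannAlgebra H)
  (α : G →* (N.toStarSubalgebra ≃⋆ₐ[ℂ] N.toStarSubalgebra))

/-- The canonical representation `π_α` of `N` on `ℓ²(G, H)`: `(π_α(x) ξ)(g) = α_{g⁻¹}(x) ξ(g)`. -/
def rep : N.toStarSubalgebra →⋆ₐ[ℂ] (ell2 G H →L[ℂ] ell2 G H) where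
  toFun x := diagonal (fun g => (α g⁻¹ x : H →L[ℂ] H)) ‖(x : H →L[ℂ] H)‖
    fun g => norm_aut_apply_le N (α g⁻¹) x
  map_one' := by ext ξ g; simp
  map_mul' x y := by ext ξ g; simp
  map_zero' := by ext ξ g; simp
  map_add' x y := by ext ξ g; simp
  commutes' c := by
    ext ξ g
    simp [Algebra.algebraMap_eq_smul_one]
  map_star' x := by
    rw [ContinuousLinearMap.star_eq_adjoint, ContinuousLinearMap.eq_adjoint_iff]
    intro ξ η
    simp only [lp.inner_eq_tsum, diagonal_apply]
    refine tsum_congr fun g => ?_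
    rw [map_star, StarMemClass.coe_star, ContinuousLinearMap.star_eq_adjoint,
      ContinuousLinearMap.adjoint_inner_left]

@[simp]
theorem rep_apply (x : N.toStarSubalgebra) (ξ : ell2 G H) (g : G) :
    rep N α x ξ g = (α g⁻¹ x : H →L[ℂ] H) (ξ g) := rfl

/-- The crossed product `N ⋊_α G`: the von Neumann algebra on `ℓ²(G, H)` generated by `π_α(N)` and
the translations `λ_h`, `h ∈ G`. -/
def crossedProduct : StarSubalgebra ℂ (ell2 G H →L[ℂ] ell2 G H) :=
  generatedVN (Set.range (rep N α) ∪ Set.range translation)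

/-- The copy `π_α(N)` of `N` in the crossed product. -/
def copyOfAlgebra : StarSubalgebra ℂ (ell2 G H →L[ℂ] ell2 G H) :=
  (rep N α).range

/-- The copy `π_α(Z(N))` of the center of `N` in the crossed product. -/
def copyOfCenter : StarSubalgebra ℂ (ell2 G H →L[ℂ] ell2 G H) :=
  (center N.toStarSubalgebra).map (rep N α)

end CrossedProduct

end CartanTriple

end

/-!
An operator on `ℓ²(G, H)` is a matrix with entries in `B(H)`, and the proof reads everything off the
matrices of the elements of `M = N ⋊ G`. Such a matrix has entries in `N`, because `M` commutes with
`1 ⊗ N'`, and it is covariant, `m(g k, h k) = α_{k⁻¹}(m(g, h))`. Hence `m` is determined by its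
Fourier coefficients `m(g, 1)`, and it belongs to the copy `π(N)` as soon as these vanish for `g ≠ 1`.

Covariance (`entry_mul_right`) rests on the automatic normality of `α_k`, in the form of
`exists_intertwiner`: for an automorphism `θ` of `N` the operators `t` with `t θ(x) = x t` separate
the vectors of `H`. To see this, start from a vector `η` and compare `x ↦ ⟪η, θ(x) η⟫` with a vector
functional `x ↦ ⟪ξ, x ξ⟫`. A maximality argument on projections gives a corner `p N p` on which the
former is dominated by the latter and `θ(p) η ≠ 0` (`exists_dominated_corner`); domination on
projections extends to positive elements by dyadic expansion (`re_nonneg_of_projections`). Then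
`x p ξ ↦ θ(x p) η` is bounded, and its adjoint is the required `t`.

If the action on the center is properly outer and `m ∈ M` commutes with `π(Z(N))`, each coefficient
`b = m(g, 1)`, `g ≠ 1`, satisfies `b d = α_{g⁻¹}(d) b` for central `d`. So `α_{g⁻¹}` fixes the center
below the central support of `b`, which must vanish (`eq_zero_of_twisted_commute`). Thus `π(N)` is the
relative commutant of `π(Z(N))`, and in particular both are von Neumann algebras. Conversely, if
`α_g` is trivial on `Z(N) z`, then `π(z) λ_g` commutes with `π(Z(N))` and has no diagonal entry, so
it can belong to `π(N)` only for `z = 0`.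

The remaining conditions hold for every action. The conditional expectation is the diagonal part
of the matrix; it is normal because least upper bounds of directed sets are weak limits
(`re_inner_le_of_isLUB`). The products `π(u) λ_g` with `u` unitary normalize `π(Z(N))`, and their span
is ultraweakly dense by von Neumann's density theorem (`generatedVN_subset_closure`).
-/

noncomputable section

open scoped InnerProductSpace
open Filter Topology

namespace CartanTriple

/-! ### Projections in a von Neumann algebra -/

section Projections

variable {H : Type*} [NormedAddCommGroup H] [InnerProductSpace ℂ H]

theorem closure_invariant {K : Submodule ℂ H} {y : H →L[ℂ] H} (h : ∀ v ∈ K, y v ∈ K) :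
    ∀ v ∈ K.topologicalClosure, y v ∈ K.topologicalClosure := by
  intro v hv
  have : Set.MapsTo y (K : Set H) K := h
  exact this.closure y.continuous hv

variable [CompleteSpace H] (N : VonNeumannAlgebra H)

/-- The projection onto a closed subspace invariant under the commutant belongs to the algebra. -/
theorem starProjection_mem {K : Submodule ℂ H} [K.HasOrthogonalProjection]
    (hK : ∀ y ∈ N.commutant, ∀ v ∈ K, y v ∈ K) : K.starProjection ∈ N := by
  rw [VonNeumannAlgebra.IsStarProjection.mem_iff isStarProjection_starProjection]
  intro y hy v hv
  rw [Submodule.range_starProjection] at hv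
  have := hK y hy v hv
  rw [Submodule.mem_comap, Submodule.range_starProjection]
  exact this

theorem re_inner_starProjection_eq {p : H →L[ℂ] H} (hp : IsStarProjection p) (v : H) :
    (⟪v, p v⟫_ℂ).re = ‖p v‖ ^ 2 := by
  have h : ⟪v, p v⟫_ℂ = ⟪p v, p v⟫_ℂ := by
    conv_rhs => rw [← ContinuousLinearMap.adjoint_inner_right, ← ContinuousLinearMap.star_eq_adjoint,
      hp.isSelfAdjoint.star_eq, ← mul_apply_eq_comp, hp.isIdempotentElem.eq]
  rw [h, inner_self_eq_norm_sq_to_K]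
  norm_cast

theorem nonneg_iff_re_inner {T : H →L[ℂ] H} :
    0 ≤ T ↔ IsSelfAdjoint T ∧ ∀ v, 0 ≤ (⟪v, T v⟫_ℂ).re := by
  rw [ContinuousLinearMap.nonneg_iff_isPositive, ContinuousLinearMap.isPositive_def']
  simp only [ContinuousLinearMap.reApplyInnerSelf]
  simp_rw [← inner_re_symm (𝕜 := ℂ) (_ : H) (T _)]
  rfl

/-- One step of the dyadic expansion of `0 ≤ a ≤ 1` into projections of `N`: with `e` the projection
onto the closed range of `(2a - 1)⁺`, the remainder `2a - e` lies again between `0` and `1`. -/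
theorem exists_dyadic_projection {a : H →L[ℂ] H} (ha : a ∈ N) (h0 : 0 ≤ a) (h1 : a ≤ 1) :
    ∃ e ∈ N, IsStarProjection e ∧ e ≤ 2 • a ∧ 2 • a - e ≤ 1 := by
  set h : H →L[ℂ] H := 2 • a - 1 with hh
  have hsa : IsSelfAdjoint h :=
    (IsSelfAdjoint.of_nonneg (nsmul_nonneg h0 2)).sub (IsSelfAdjoint.one _)
  set K : Submodule ℂ H := (LinearMap.range (h⁺ : H →L[ℂ] H).toLinearMap).topologicalClosure with hK
  have hKN : ∀ y ∈ N.commutant, ∀ v ∈ K, y v ∈ K := by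
    intro y hy
    refine closure_invariant ?_
    rintro _ ⟨w, rfl⟩
    have hc : Commute h y := by
      rw [VonNeumannAlgebra.mem_commutant_iff] at hy
      have : Commute a y := hy a ha
      exact ((this.smul_left 2).sub_left (Commute.one_left y))
    have hc' : Commute (h⁺) y := hc.cfcₙ_real _
    exact ⟨y w, DFunLike.congr_fun hc'.eq w⟩
  refine ⟨K.starProjection, starProjection_mem N hKN, isStarProjection_starProjection, ?_⟩
  set e := K.starProjection with he
  have hep : IsStarProjection e := isStarProjection_starProjection
  have e1 : e * h⁺ = h⁺ := by
    ext v
    exact Submodule.starProjection_eq_self_iff.2 (Submodule.le_topologicalClosure _ ⟨v, rfl⟩)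
  have e1' : h⁺ * e = h⁺ := by
    have := congrArg star e1
    rwa [star_mul, hep.isSelfAdjoint.star_eq, (CFC.posPart_nonneg h).isSelfAdjoint.star_eq] at this
  have e2 : h⁻ * e = 0 := by
    ext v
    have hv : e v ∈ K := Submodule.starProjection_apply_mem _ _
    have : K ≤ LinearMap.ker (h⁻ : H →L[ℂ] H).toLinearMap := by
      refine Submodule.topologicalClosure_minimal _ ?_ (h⁻ : H →L[ℂ] H).isClosed_ker
      rintro _ ⟨w, rfl⟩
      exact DFunLike.congr_fun (CFC.negPart_mul_posPart h) w
    exact this hv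
  have e2' : e * h⁻ = 0 := by
    have := congrArg star e2
    rwa [star_mul, hep.isSelfAdjoint.star_eq, (CFC.negPart_nonneg h).isSelfAdjoint.star_eq,
      star_zero] at this
  have ea : 2 • a = 1 + h⁺ - h⁻ := by
    rw [add_sub_assoc, CFC.posPart_sub_negPart h hsa, hh]; abel
  have i1 : h⁻ ≤ 1 - e := by
    have := star_left_conjugate_nonneg (nsmul_nonneg h0 2) (1 - e)
    rw [hep.one_sub.isSelfAdjoint.star_eq, ea] at this
    have q : (1 - e) * (1 + h⁺ - h⁻) * (1 - e) = (1 - e) - h⁻ := by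
      simp only [sub_mul, mul_sub, mul_add, add_mul, one_mul, mul_one, e1, e1', e2, e2',
        hep.isIdempotentElem.eq, zero_mul]
      abel
    rw [q] at this
    exact sub_nonneg.1 this
  have i2 : h⁺ ≤ e := by
    have := star_left_conjugate_le_conjugate (nsmul_le_nsmul_right h1 2) e
    rw [hep.isSelfAdjoint.star_eq, ea] at this
    have q : e * (1 + h⁺ - h⁻) * e = e + h⁺ := by
      simp only [mul_sub, sub_mul, mul_add, add_mul, mul_one, e1, e1', e2',
        hep.isIdempotentElem.eq, zero_mul]
      abel
    have q' : e * (2 • (1 : H →L[ℂ] H)) * e = e + e := by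
      rw [two_nsmul, mul_add, add_mul, mul_one, hep.isIdempotentElem.eq]
    rw [q, q'] at this
    exact le_of_add_le_add_left this
  have p1 := CFC.posPart_nonneg h
  have p2 := CFC.negPart_nonneg h
  constructor
  · rw [ea, ← sub_nonneg]
    have := add_nonneg (sub_nonneg.2 i1) p1
    convert this using 1; abel
  · rw [ea, ← sub_nonneg]
    have := add_nonneg (sub_nonneg.2 i2) p2
    convert this using 1; abel

theorem mul_eq_of_le_two_nsmul {e p a : H →L[ℂ] H} (he : IsStarProjection e)
    (hap : a * p = a) (h : e ≤ 2 • a) : e * p = e := by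
  have : e * (1 - p) = 0 := by
    ext v
    set w := (1 - p) v with hw
    have haw : a w = 0 := by
      rw [hw, ← mul_apply_eq_comp, mul_sub, mul_one, hap, sub_self]; rfl
    have h2 := (nonneg_iff_re_inner.1 (sub_nonneg.2 h)).2 w
    have h3 : ((2 • a - e : H →L[ℂ] H)) w = - e w := by
      simp [haw]
    rw [h3, inner_neg_right, Complex.neg_re, re_inner_starProjection_eq he] at h2
    have : ‖e w‖ = 0 := by nlinarith [norm_nonneg (e w)]
    exact norm_eq_zero.1 this
  rw [mul_sub, mul_one, sub_eq_zero] at this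
  exact this.symm

/-- A bounded functional on `N` whose real part is nonnegative on the projections below `p` has
nonnegative real part on all positive elements of the corner `p N p`. -/
theorem re_nonneg_of_projections (f : N.toStarSubalgebra →ₗ[ℂ] ℂ) (C : ℝ) (hC0 : 0 ≤ C)
    (hC : ∀ y, ‖f y‖ ≤ C * ‖(y : H →L[ℂ] H)‖) (p : N.toStarSubalgebra)
    (hf : ∀ q, IsStarProjection q → q * p = q → 0 ≤ (f q).re) (y : N.toStarSubalgebra)
    (hy : 0 ≤ (y : H →L[ℂ] H)) (hyp : y * p = y) : 0 ≤ (f y).re := by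
  -- each dyadic step halves the lower bound: `2 y = e + y'` with `e` a projection and `0 ≤ y' ≤ 1`
  have key : ∀ n : ℕ, ∀ y : N.toStarSubalgebra, 0 ≤ (y : H →L[ℂ] H) → (y : H →L[ℂ] H) ≤ 1 →
      y * p = y → -(C / 2 ^ n) ≤ (f y).re := by
    intro n
    induction n with
    | zero =>
      intro y h0 h1 _
      have := (CStarAlgebra.norm_le_one_iff_of_nonneg (y : H →L[ℂ] H) h0).2 h1
      have h2 := (Complex.abs_re_le_norm (f y)).trans (hC y)
      have := (abs_le.1 (h2.trans (mul_le_of_le_one_right hC0 this))).1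
      simpa using this
    | succ n ih =>
      intro y h0 h1 hyp
      obtain ⟨e, heN, he, hle, hle'⟩ := exists_dyadic_projection N y.2 h0 h1
      set e' : N.toStarSubalgebra := ⟨e, heN⟩
      have hep : e' * p = e' := Subtype.ext
        (mul_eq_of_le_two_nsmul he (congrArg Subtype.val hyp) hle)
      have hes : IsStarProjection e' := ⟨Subtype.ext he.isIdempotentElem, Subtype.ext he.isSelfAdjoint⟩
      have h3 := hf e' hes hep
      have hcoe : ((2 • y - e' : N.toStarSubalgebra) : H →L[ℂ] H) = 2 • (y : H →L[ℂ] H) - e := rfl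
      have h4 := ih (2 • y - e') (by rw [hcoe]; exact sub_nonneg.2 hle) (by rw [hcoe]; exact hle')
        (by rw [sub_mul, hep, smul_mul_assoc, hyp])
      rw [map_sub, map_nsmul, Complex.sub_re, nsmul_eq_mul, Complex.mul_re] at h4
      simp at h4
      rw [pow_succ, ← div_div]
      linarith
  have key' : ∀ y : N.toStarSubalgebra, 0 ≤ (y : H →L[ℂ] H) → (y : H →L[ℂ] H) ≤ 1 →
      y * p = y → 0 ≤ (f y).re := by
    intro y h0 h1 h2
    have hl : Tendsto (fun n : ℕ => -(C / 2 ^ n)) atTop (𝓝 0) := by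
      have := (tendsto_pow_atTop_nhds_zero_of_lt_one (r := (1 / 2 : ℝ)) (by norm_num)
        (by norm_num)).const_mul (-C)
      simp only [mul_zero] at this
      refine this.congr fun n => ?_
      rw [one_div, inv_pow, neg_mul, div_eq_mul_inv]
    exact le_of_tendsto' hl fun n => key n y h0 h1 h2
  set r : ℝ := (1 + ‖(y : H →L[ℂ] H)‖)⁻¹ with hr
  have hr0 : 0 < r := by positivity
  have hs : ((((r : ℂ) • y : N.toStarSubalgebra)) : H →L[ℂ] H) = (r : ℝ) • (y : H →L[ℂ] H) := by
    ext; simp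
  have h5 := key' ((r : ℂ) • y) (by rw [hs]; exact smul_nonneg hr0.le hy)
    (by
      rw [hs, ← CStarAlgebra.norm_le_one_iff_of_nonneg _ (smul_nonneg hr0.le hy), norm_smul,
        Real.norm_of_nonneg hr0.le, hr, inv_mul_le_iff₀ (by positivity)]
      linarith [norm_nonneg (y : H →L[ℂ] H)])
    (by rw [smul_mul_assoc, hyp])
  rw [map_smul, smul_eq_mul, Complex.re_ofReal_mul] at h5
  exact nonneg_of_mul_nonneg_right h5 hr0

end Projections

/-! ### Intertwiners between an automorphism and the identity -/

section Intertwiners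

variable {H : Type*} [NormedAddCommGroup H] [InnerProductSpace ℂ H] [CompleteSpace H]
  (N : VonNeumannAlgebra H)

/-- The functional `x ↦ ⟪η, θ x η⟫ - ⟪ξ, x ξ⟫` on `N`. -/
def comparison (θ : N.toStarSubalgebra ≃⋆ₐ[ℂ] N.toStarSubalgebra) (η ξ : H) :
    N.toStarSubalgebra →ₗ[ℂ] ℂ where
  toFun x := ⟪η, (θ x : H →L[ℂ] H) η⟫_ℂ - ⟪ξ, (x : H →L[ℂ] H) ξ⟫_ℂ
  map_add' x y := by simp; ring
  map_smul' c x := by simp; ring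

variable {N}

theorem isStarProjection_coe_iff {q : N.toStarSubalgebra} :
    IsStarProjection (q : H →L[ℂ] H) ↔ IsStarProjection q :=
  ⟨fun h => ⟨Subtype.ext h.isIdempotentElem, Subtype.ext h.isSelfAdjoint⟩,
    fun h => ⟨congrArg Subtype.val h.isIdempotentElem, congrArg Subtype.val h.isSelfAdjoint⟩⟩

theorem re_comparison (θ : N.toStarSubalgebra ≃⋆ₐ[ℂ] N.toStarSubalgebra) (η ξ : H)
    {q : N.toStarSubalgebra} (hq : IsStarProjection q) :
    (comparison N θ η ξ q).re = ‖(θ q : H →L[ℂ] H) η‖ ^ 2 - ‖(q : H →L[ℂ] H) ξ‖ ^ 2 := by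
  have h2 : IsStarProjection (θ q : H →L[ℂ] H) := isStarProjection_coe_iff.2 (hq.map θ)
  simp [comparison, re_inner_starProjection_eq h2,
    re_inner_starProjection_eq (isStarProjection_coe_iff.2 hq)]

theorem norm_comparison_le (θ : N.toStarSubalgebra ≃⋆ₐ[ℂ] N.toStarSubalgebra) (η ξ : H)
    (y : N.toStarSubalgebra) :
    ‖comparison N θ η ξ y‖ ≤ (‖η‖ ^ 2 + ‖ξ‖ ^ 2) * ‖(y : H →L[ℂ] H)‖ := by
  have h1 : ‖⟪η, (θ y : H →L[ℂ] H) η⟫_ℂ‖ ≤ ‖η‖ * (‖(y : H →L[ℂ] H)‖ * ‖η‖) :=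
    (norm_inner_le_norm _ _).trans (by
      gcongr
      exact ((θ y : H →L[ℂ] H).le_opNorm η).trans (by
        gcongr
        exact norm_aut_apply_le N θ y))
  have h2 : ‖⟪ξ, (y : H →L[ℂ] H) ξ⟫_ℂ‖ ≤ ‖ξ‖ * (‖(y : H →L[ℂ] H)‖ * ‖ξ‖) :=
    (norm_inner_le_norm _ _).trans (by
      gcongr
      exact (y : H →L[ℂ] H).le_opNorm ξ)
  calc _ ≤ _ := norm_sub_le _ _
    _ ≤ _ := add_le_add h1 h2
    _ = _ := by ring

/-- A nonempty chain of projections of `N` has a supremum `P` among the projections of `N`, and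
`‖P ξ‖` is the supremum of the `‖q ξ‖`. -/
theorem exists_chain_sup {c : Set N.toStarSubalgebra} (hc : IsChain (· ≤ ·) c)
    (hne : c.Nonempty) (hproj : ∀ q ∈ c, IsStarProjection q) :
    ∃ P : N.toStarSubalgebra, IsStarProjection P ∧ (∀ q ∈ c, P * q = q) ∧
      (∀ f : N.toStarSubalgebra, (∀ q ∈ c, f * q = q) → f * P = P) ∧
      ∀ (ξ : H) (C : ℝ), (∀ q ∈ c, ‖(q : H →L[ℂ] H) ξ‖ ≤ C) → ‖(P : H →L[ℂ] H) ξ‖ ≤ C := by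
  have hsp : ∀ q : c, ∃ U : Submodule ℂ H, ∃ _ : U.HasOrthogonalProjection,
      (q : H →L[ℂ] H) = U.starProjection := by
    intro q
    exact isStarProjection_iff_eq_starProjection.1 (isStarProjection_coe_iff.2 (hproj q q.2))
  choose U hU hqU using hsp
  have hmono : Monotone U := by
    intro q q' h
    rw [← Submodule.starProjection_le_starProjection_iff, ← hqU, ← hqU]
    exact h
  set K := (⨆ q, U q).topologicalClosure with hK
  have hinv : ∀ y ∈ N.commutant, ∀ v ∈ K, y v ∈ K := by
    intro y hy
    refine closure_invariant fun v hv => ?_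
    have : (⨆ q, U q) ≤ (⨆ q, U q).comap y.toLinearMap := by
      refine iSup_le fun q v hv => ?_
      refine Submodule.mem_iSup_of_mem q ?_
      have h1 := (VonNeumannAlgebra.mem_commutant_iff.1 hy) _ (q : N.toStarSubalgebra).2
      rw [hqU] at h1
      have h2 := DFunLike.congr_fun h1 v
      rw [mul_apply_eq_comp, mul_apply_eq_comp, Submodule.starProjection_eq_self_iff.2 hv] at h2
      exact Submodule.starProjection_eq_self_iff.1 h2
    exact this hv
  have hle : ∀ q, U q ≤ K := fun q => (le_iSup U q).trans (Submodule.le_topologicalClosure _)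
  refine ⟨⟨K.starProjection, starProjection_mem N hinv⟩,
    isStarProjection_coe_iff.1 isStarProjection_starProjection, ?_, ?_, ?_⟩
  · intro q hq
    refine Subtype.ext (ContinuousLinearMap.ext fun v => ?_)
    change K.starProjection ((q : H →L[ℂ] H) v) = (q : H →L[ℂ] H) v
    refine Submodule.starProjection_eq_self_iff.2 (hle ⟨q, hq⟩ ?_)
    rw [show (q : H →L[ℂ] H) = (U ⟨q, hq⟩).starProjection from hqU ⟨q, hq⟩]
    exact Submodule.starProjection_apply_mem _ _
  · intro f hf
    have hKf : K ≤ LinearMap.ker ((f : H →L[ℂ] H) - 1).toLinearMap := by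
      refine Submodule.topologicalClosure_minimal _ (iSup_le fun q v hv => ?_)
        (ContinuousLinearMap.isClosed_ker _)
      have h1 := congrArg Subtype.val (hf q q.2)
      have h2 := DFunLike.congr_fun h1 v
      simp only [MulMemClass.coe_mul, mul_apply_eq_comp, hqU] at h2
      rw [Submodule.starProjection_eq_self_iff.2 hv] at h2
      simp [h2]
    refine Subtype.ext (ContinuousLinearMap.ext fun v => ?_)
    have := hKf (Submodule.starProjection_apply_mem K v)
    simpa [sub_eq_zero] using this
  · intro ξ C hC
    have : Nonempty c := hne.to_subtype
    have : IsDirectedOrder c := ⟨fun a b => by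
      rcases hc.total a.2 b.2 with h | h
      · exact ⟨b, h, le_rfl⟩
      · exact ⟨a, le_rfl, h⟩⟩
    have := (Submodule.starProjection_tendsto_closure_iSup U hmono ξ).norm
    refine le_of_tendsto' this fun q => ?_
    rw [← hqU]
    exact hC q q.2

/-- For `η ≠ 0` there is a projection `p` such that `θ p` does not kill `η` and the functional
`x ↦ ⟪η, θ x η⟫` is dominated by a vector functional on the corner `p N p`. Normality of `θ` is not
presupposed: only the order isomorphism that `θ` induces between projections is used. -/
theorem exists_dominated_corner (θ : N.toStarSubalgebra ≃⋆ₐ[ℂ] N.toStarSubalgebra) {η : H}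
    (hη : η ≠ 0) : ∃ (p : N.toStarSubalgebra) (ξ : H), IsStarProjection p ∧
      (θ p : H →L[ℂ] H) η ≠ 0 ∧
      ∀ q : N.toStarSubalgebra, IsStarProjection q → q * p = q →
        (comparison N θ η ξ q).re ≤ 0 := by
  -- the cyclic projection `s` onto the closure of `N' η` belongs to `N`
  set K : Submodule ℂ H := (Submodule.map (LinearMap.applyₗ η ∘ₗ
      ContinuousLinearMap.coeLM ℂ : (H →L[ℂ] H) →ₗ[ℂ] H)
    N.commutant.toStarSubalgebra.toSubalgebra.toSubmodule).topologicalClosure with hK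
  have hinv : ∀ y ∈ N.commutant, ∀ v ∈ K, y v ∈ K := by
    intro y hy
    refine closure_invariant ?_
    rintro _ ⟨w, hw, rfl⟩
    exact ⟨y * w, mul_mem (s := N.commutant) hy hw, rfl⟩
  set s : N.toStarSubalgebra := ⟨K.starProjection, starProjection_mem N hinv⟩ with hs
  have hsp : IsStarProjection s := isStarProjection_coe_iff.1 isStarProjection_starProjection
  have hηK : η ∈ K := Submodule.le_topologicalClosure _
    ⟨1, one_mem N.commutant, rfl⟩
  have hsη : (s : H →L[ℂ] H) η = η := Submodule.starProjection_eq_self_iff.2 hηK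
  have hsep : ∀ x : N.toStarSubalgebra, (x : H →L[ℂ] H) η = 0 → x * s = 0 := by
    intro x hx
    have hKx : K ≤ LinearMap.ker (x : H →L[ℂ] H).toLinearMap := by
      refine Submodule.topologicalClosure_minimal _ ?_ (ContinuousLinearMap.isClosed_ker _)
      rintro _ ⟨w, hw, rfl⟩
      have := DFunLike.congr_fun (VonNeumannAlgebra.mem_commutant_iff.1 hw x x.2) η
      rw [mul_apply_eq_comp, mul_apply_eq_comp, hx, map_zero] at this
      exact this
    exact Subtype.ext (ContinuousLinearMap.ext fun v =>
      hKx (Submodule.starProjection_apply_mem K v))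
  set f := θ.symm s with hf
  have hθf : θ f = s := θ.apply_symm_apply s
  have hfp : IsStarProjection f := hsp.map θ.symm
  have hf0 : (f : H →L[ℂ] H) ≠ 0 := by
    intro h
    have : f = 0 := Subtype.ext h
    rw [this, map_zero] at hθf
    rw [← hθf] at hsη
    exact hη hsη.symm
  obtain ⟨v, hv⟩ : ∃ v, (f : H →L[ℂ] H) v ≠ 0 := by
    by_contra! h
    exact hf0 (ContinuousLinearMap.ext h)
  -- a vector in the range of `f` of larger norm than `η`
  obtain ⟨ξ, hfξ, hξ⟩ : ∃ ξ, (f : H →L[ℂ] H) ξ = ξ ∧ ‖η‖ < ‖ξ‖ := by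
    set w := (f : H →L[ℂ] H) v
    have hw : (f : H →L[ℂ] H) w = w :=
      DFunLike.congr_fun (congrArg Subtype.val hfp.isIdempotentElem.eq) v
    have hw0 : 0 < ‖w‖ := norm_pos_iff.2 hv
    refine ⟨(((‖η‖ + 1) / ‖w‖ : ℝ) : ℂ) • w, by rw [map_smul, hw], ?_⟩
    rw [norm_smul, Complex.norm_real, Real.norm_of_nonneg (by positivity),
      div_mul_cancel₀ _ hw0.ne']
    linarith
  set D := comparison N θ η ξ with hD
  -- let `q₀ ≤ f` be maximal with `‖q₀ ξ‖ ≤ ‖θ q₀ η‖`: the inequality is then reversed on every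
  -- projection below `f - q₀`
  set Q : Set N.toStarSubalgebra := {q | IsStarProjection q ∧ f * q = q ∧ 0 ≤ (D q).re} with hQ
  obtain ⟨q₀, -, hq₀⟩ : ∃ m, 0 ≤ m ∧ Maximal (· ∈ Q) m := by
    refine zorn_le_nonempty₀ Q ?_ 0 ⟨.zero _, mul_zero _, by simp⟩
    intro c hcQ hc q hq
    obtain ⟨P, hP, hPq, hPf, hPn⟩ := exists_chain_sup hc ⟨q, hq⟩ fun q hq => (hcQ hq).1
    refine ⟨P, ⟨hP, hPf f fun q hq => (hcQ hq).2.1, ?_⟩, fun q hq => ?_⟩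
    · rw [hD, re_comparison θ η ξ hP, sub_nonneg]
      refine pow_le_pow_left₀ (norm_nonneg _) (hPn ξ _ fun q hq => ?_) 2
      have h1 := (hcQ hq).2.2
      rw [hD, re_comparison θ η ξ (hcQ hq).1, sub_nonneg] at h1
      refine (abs_le_of_sq_le_sq' h1 (norm_nonneg _)).2.trans ?_
      have h2 : q * P = q := by
        have := congrArg star (hPq q hq)
        rwa [star_mul, hP.isSelfAdjoint.star_eq, (hcQ hq).1.isSelfAdjoint.star_eq] at this
      have h3 : (θ q : H →L[ℂ] H) η = (θ q : H →L[ℂ] H) ((θ P : H →L[ℂ] H) η) := by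
        conv_lhs => rw [← h2, map_mul]
        rfl
      rw [h3]
      exact ContinuousLinearMap.le_of_opNorm_le_of_le _
        (isStarProjection_coe_iff.2 ((hcQ hq).1.map θ)).norm_le le_rfl |>.trans_eq (one_mul _)
    · exact (isStarProjection_coe_iff.2 (hcQ hq).1).le_of_mul_eq_right
        (isStarProjection_coe_iff.2 hP) (congrArg Subtype.val (hPq q hq))
  obtain ⟨hq₀p, hfq₀, hDq₀⟩ := hq₀.1
  have hq₀f : q₀ * f = q₀ := by
    have := congrArg star hfq₀
    rwa [star_mul, hq₀p.isSelfAdjoint.star_eq, hfp.isSelfAdjoint.star_eq] at this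
  have hp : IsStarProjection (f - q₀) := hq₀p.sub_of_mul_eq_left hfp hq₀f
  refine ⟨f - q₀, ξ, hp, fun h0 => ?_, fun q hq hqp => ?_⟩
  · have h1 := hsep _ h0
    rw [← hθf, ← map_mul, sub_mul, hfp.isIdempotentElem.eq, hq₀f] at h1
    have h2 : f - q₀ = 0 := (map_eq_zero_iff θ (EquivLike.injective θ)).1 (by simpa using h1)
    rw [← sub_eq_zero.1 h2, hD, re_comparison θ η ξ hfp, hθf, hsη, hfξ] at hDq₀
    nlinarith [norm_nonneg η]
  · by_contra! hlt
    have hqq₀ : q * q₀ = 0 := by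
      rw [← hqp, mul_assoc, sub_mul, hfq₀, hq₀p.isIdempotentElem.eq, sub_self, mul_zero]
    have hq₀q : q₀ * q = 0 := by
      have := congrArg star hqq₀
      rwa [star_mul, hq₀p.isSelfAdjoint.star_eq, hq.isSelfAdjoint.star_eq, star_zero] at this
    have hpq : (f - q₀) * q = q := by
      have := congrArg star hqp
      rwa [star_mul, hp.isSelfAdjoint.star_eq, hq.isSelfAdjoint.star_eq] at this
    have hfq : f * q = q := by
      rwa [sub_mul, hq₀q, sub_zero] at hpq
    have hsum : IsStarProjection (q₀ + q) := hq₀p.add hq hq₀q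
    have hmem : q₀ + q ∈ Q := by
      refine ⟨hsum, by rw [mul_add, hfq₀, hfq], ?_⟩
      rw [map_add, Complex.add_re]
      linarith
    have hle : q₀ ≤ q₀ + q := by
      have : (0 : H →L[ℂ] H) ≤ q := (isStarProjection_coe_iff.2 hq).nonneg
      exact le_add_of_nonneg_right (a := (q₀ : H →L[ℂ] H)) this
    have h3 := hq₀.2 hmem hle
    have h4 : (q : H →L[ℂ] H) ≤ 0 := by
      have : (q₀ : H →L[ℂ] H) + q ≤ q₀ + 0 := by rw [add_zero]; exact h3
      exact le_of_add_le_add_left this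
    have h5 : q = 0 := Subtype.ext (le_antisymm h4 (isStarProjection_coe_iff.2 hq).nonneg)
    rw [h5, map_zero] at hlt
    exact lt_irrefl _ hlt

/-- The intertwiners between `θ`, seen as a representation of `N` on `H`, and the identity
representation separate the vectors of `H`. This is how the automatic normality of automorphisms of
von Neumann algebras enters the proof. -/
theorem exists_intertwiner (θ : N.toStarSubalgebra ≃⋆ₐ[ℂ] N.toStarSubalgebra) {η : H}
    (hη : η ≠ 0) : ∃ t : H →L[ℂ] H,
      (∀ x : N.toStarSubalgebra, t * (θ x : H →L[ℂ] H) = (x : H →L[ℂ] H) * t) ∧ t η ≠ 0 := by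
  obtain ⟨p, ξ, hp, hpη, hdom⟩ := exists_dominated_corner θ hη
  -- positivity of the comparison on the corner, evaluated at `(x p)* (x p)`
  have hbound : ∀ x : N.toStarSubalgebra,
      ‖(θ (x * p) : H →L[ℂ] H) η‖ ≤ 1 * ‖((x * p : N.toStarSubalgebra) : H →L[ℂ] H) ξ‖ := by
    intro x
    have h1 := re_nonneg_of_projections N (-(comparison N θ η ξ)) (‖η‖ ^ 2 + ‖ξ‖ ^ 2)
      (by positivity) (fun y => by
        rw [LinearMap.neg_apply, norm_neg]; exact norm_comparison_le θ η ξ y) p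
      (fun q hq hqp => by simpa using hdom q hq hqp) (star (x * p) * (x * p))
      (star_mul_self_nonneg ((x * p : N.toStarSubalgebra) : H →L[ℂ] H))
      (by rw [mul_assoc, mul_assoc, hp.isIdempotentElem.eq])
    have h2 : ∀ (a : H →L[ℂ] H) (v : H), ⟪v, (star a * a) v⟫_ℂ = ((‖a v‖ ^ 2 : ℝ) : ℂ) := by
      intro a v
      rw [mul_apply_eq_comp, ContinuousLinearMap.star_eq_adjoint,
        ContinuousLinearMap.adjoint_inner_right, inner_self_eq_norm_sq_to_K]
      norm_cast
    have h3 : comparison N θ η ξ (star (x * p) * (x * p)) =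
        ((‖(θ (x * p) : H →L[ℂ] H) η‖ ^ 2 : ℝ) : ℂ) -
          ((‖((x * p : N.toStarSubalgebra) : H →L[ℂ] H) ξ‖ ^ 2 : ℝ) : ℂ) := by
      rw [← h2, ← h2]
      change ⟪η, (θ (star (x * p) * (x * p)) : H →L[ℂ] H) η⟫_ℂ - _ = _
      rw [map_mul, map_star]
      rfl
    rw [LinearMap.neg_apply, h3, ← Complex.ofReal_sub, ← Complex.ofReal_neg, Complex.ofReal_re] at h1
    rw [one_mul]
    exact (abs_le_of_sq_le_sq' (by linarith) (norm_nonneg _)).2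
  -- the two linear maps `x ↦ (x p) ξ` and `x ↦ θ (x p) η`
  let ev (v : H) : N.toStarSubalgebra →ₗ[ℂ] H :=
    { toFun := fun x => (x : H →L[ℂ] H) v
      map_add' := fun x y => rfl
      map_smul' := fun c x => rfl }
  let e₀ : N.toStarSubalgebra →ₗ[ℂ] H := ev ξ ∘ₗ LinearMap.mulRight ℂ p
  let f : N.toStarSubalgebra →ₗ[ℂ] H :=
    ev η ∘ₗ (θ : N.toStarSubalgebra →ₐ[ℂ] N.toStarSubalgebra).toLinearMap ∘ₗ LinearMap.mulRight ℂ p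
  set K : Submodule ℂ H := (LinearMap.range e₀).topologicalClosure with hK
  have hKinv : ∀ x ∈ N, ∀ v ∈ K, x v ∈ K := by
    intro x hx
    refine closure_invariant ?_
    rintro _ ⟨y, rfl⟩
    exact ⟨⟨x, hx⟩ * y, rfl⟩
  have hKc : K.starProjection ∈ N.commutant := starProjection_mem N.commutant (by
    rwa [VonNeumannAlgebra.commutant_commutant])
  have heK : ∀ x, e₀ x ∈ K := fun x => Submodule.le_topologicalClosure _ ⟨x, rfl⟩
  let e : N.toStarSubalgebra →ₗ[ℂ] K := e₀.codRestrict K heK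
  have hdense : DenseRange e := by
    intro u
    rw [closure_subtype]
    have hu : (u : H) ∈ closure (Set.range e₀) := u.2
    rwa [← Set.range_comp]
  -- the map `x p ξ ↦ θ (x p) η`, extended to the closure `K` of `N p ξ` and by zero to `Kᗮ`
  set v₀ : K →L[ℂ] H := f.extendOfNorm e with hv₀
  have hv₀e : ∀ x, v₀ (e x) = f x :=
    LinearMap.extendOfNorm_eq hdense ⟨1, fun x => hbound x⟩
  set v : H →L[ℂ] H := v₀ ∘L K.orthogonalProjectionOnto with hv
  have hint : ∀ x : N.toStarSubalgebra, v * (x : H →L[ℂ] H) = (θ x : H →L[ℂ] H) * v := by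
    intro x
    let xK : K →L[ℂ] K := ((x : H →L[ℂ] H) ∘L K.subtypeL).codRestrict K
      fun u => hKinv x x.2 u u.2
    have h1 : ∀ u, v₀ (xK u) = (θ x : H →L[ℂ] H) (v₀ u) := by
      refine congrFun (hdense.equalizer (by fun_prop) (by fun_prop) (funext fun y => ?_))
      have h2 : xK (e y) = e (x * y) := rfl
      change v₀ (xK (e y)) = (θ x : H →L[ℂ] H) (v₀ (e y))
      rw [h2, hv₀e, hv₀e]
      change (θ (x * y * p) : H →L[ℂ] H) η = (θ x : H →L[ℂ] H) ((θ (y * p) : H →L[ℂ] H) η)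
      rw [mul_assoc, map_mul]
      rfl
    ext w
    have h3 : K.orthogonalProjectionOnto ((x : H →L[ℂ] H) w) =
        xK (K.orthogonalProjectionOnto w) := by
      have h4 := VonNeumannAlgebra.mem_commutant_iff.1 hKc x x.2
      exact Subtype.ext (DFunLike.congr_fun h4 w).symm
    change v₀ (K.orthogonalProjectionOnto ((x : H →L[ℂ] H) w)) = _
    rw [h3, h1]
    rfl
  refine ⟨star v, fun x => ?_, fun h0 => ?_⟩
  · have := congrArg star (hint (star x))
    rw [map_star] at this
    simpa using this.symm
  · -- `⟪star v η, p ξ⟫ = ⟪η, θ p η⟫ = ‖θ p η‖ ^ 2 ≠ 0`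
    have h1 : v (e₀ 1) = f 1 := by
      have : K.orthogonalProjectionOnto (e₀ 1) = e 1 :=
        Submodule.orthogonalProjectionOnto_mem_subspace_eq_self (e 1)
      rw [← hv₀e, ← this]
      rfl
    have h2 : f 1 = (θ p : H →L[ℂ] H) η := by
      change (θ (1 * p) : H →L[ℂ] H) η = _
      rw [one_mul]
    have h3 : ⟪η, f 1⟫_ℂ = 0 := by
      rw [← h1, ← ContinuousLinearMap.adjoint_inner_left, ← ContinuousLinearMap.star_eq_adjoint, h0,
        inner_zero_left]
    have h4 := re_inner_starProjection_eq (isStarProjection_coe_iff.2 (hp.map θ)) η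
    rw [← h2, h3, Complex.zero_re] at h4
    rw [← h2] at hpη
    exact hpη (norm_eq_zero.1 (pow_eq_zero_iff two_ne_zero |>.1 h4.symm))

end Intertwiners

/-! ### Operator matrices on `ℓ²(G, H)` -/

section Entries

variable {H : Type*} [NormedAddCommGroup H] [InnerProductSpace ℂ H] {G : Type*}

open Classical in
/-- The isometric embedding of `H` into `ℓ²(G, H)` as the functions supported at `h`. -/
def single (h : G) : H →L[ℂ] ell2 G H :=
  lp.singleContinuousLinearMap ℂ (fun _ => H) 2 h

theorem single_apply_self (h : G) (v : H) : single h v h = v := by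
  classical exact lp.single_apply_self (E := fun _ : G => H) 2 h v

theorem single_apply_of_ne {g h : G} (hgh : g ≠ h) (v : H) : single h v g = 0 := by
  classical exact lp.single_apply_ne (E := fun _ : G => H) 2 h v hgh

theorem hasSum_single (ξ : ell2 G H) : HasSum (fun g => single g (ξ g)) ξ := by
  classical
  exact lp.hasSum_single (E := fun _ : G => H) (p := 2) (by norm_num) ξ

theorem inner_single (h : G) (v : H) (ξ : ell2 G H) : ⟪(single h v : ell2 G H), ξ⟫_ℂ = ⟪v, ξ h⟫_ℂ := by
  classical
  exact lp.inner_single_left (G := fun _ : G => H) h v ξ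

/-- The matrix entry at `(g, h)` of an operator on `ℓ²(G, H)`. -/
def entry (T : ell2 G H →L[ℂ] ell2 G H) (g h : G) : H →L[ℂ] H :=
  lp.evalCLM ℂ (fun _ => H) 2 g ∘L T ∘L single h

@[simp]
theorem entry_apply (T : ell2 G H →L[ℂ] ell2 G H) (g h : G) (v : H) :
    entry T g h v = T (single h v) g := rfl

theorem ext_single {S T : ell2 G H →L[ℂ] ell2 G H} (h : ∀ g v, S (single g v) = T (single g v)) :
    S = T := by
  ext1 ξ
  have h1 := (hasSum_single ξ).mapL S
  have h2 := (hasSum_single ξ).mapL T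
  simp_rw [h] at h1
  exact h1.unique h2

theorem ext_entry {S T : ell2 G H →L[ℂ] ell2 G H} (h : ∀ g k, entry S g k = entry T g k) :
    S = T :=
  ext_single fun k v => lp.ext (funext fun g => DFunLike.congr_fun (h g k) v)

theorem inner_entry (T : ell2 G H →L[ℂ] ell2 G H) (g h : G) (v w : H) :
    ⟪v, entry T g h w⟫_ℂ = ⟪single g v, T (single h w)⟫_ℂ := by
  rw [inner_single, entry_apply]

theorem diagonal_single (T : G → H →L[ℂ] H) (C : ℝ) (hT : ∀ g, ‖T g‖ ≤ C) (h : G) (v : H) :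
    diagonal T C hT (single h v) = single h (T h v) := by
  ext g
  rw [diagonal_apply]
  rcases eq_or_ne g h with rfl | hgh
  · rw [single_apply_self, single_apply_self]
  · rw [single_apply_of_ne hgh, single_apply_of_ne hgh, map_zero]

theorem entry_diagonal_self (T : G → H →L[ℂ] H) (C : ℝ) (hT : ∀ g, ‖T g‖ ≤ C) (g : G) :
    entry (diagonal T C hT) g g = T g := by
  ext v
  rw [entry_apply, diagonal_apply, single_apply_self]

theorem entry_diagonal_of_ne (T : G → H →L[ℂ] H) (C : ℝ) (hT : ∀ g, ‖T g‖ ≤ C) {g h : G}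
    (hgh : g ≠ h) : entry (diagonal T C hT) g h = 0 := by
  ext v
  rw [entry_apply, diagonal_apply, single_apply_of_ne hgh, map_zero, zero_apply]

/-- The operator `1 ⊗ y` on `ℓ²(G, H) = ℓ²(G) ⊗ H`. -/
def amplify (G : Type*) (y : H →L[ℂ] H) : ell2 G H →L[ℂ] ell2 G H :=
  diagonal (fun _ => y) ‖y‖ fun _ => le_rfl

@[simp]
theorem amplify_apply (y : H →L[ℂ] H) (ξ : ell2 G H) (g : G) : amplify G y ξ g = y (ξ g) := rfl

theorem amplify_single (y : H →L[ℂ] H) (g : G) (v : H) :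
    amplify G y (single g v) = single g (y v) :=
  diagonal_single _ _ _ _ _

/-- The commutant of `1 ⊗ y` consists of the operators whose entries commute with `y`. -/
theorem amplify_commute_iff {T : ell2 G H →L[ℂ] ell2 G H} {y : H →L[ℂ] H} :
    T * amplify G y = amplify G y * T ↔ ∀ g h, entry T g h * y = y * entry T g h := by
  constructor
  · intro hT g h
    ext v
    have h1 := congrArg (fun ξ : ell2 G H => ξ g) (DFunLike.congr_fun hT (single h v))
    simpa [mul_apply_eq_comp, amplify_single] using h1
  · intro hT
    refine ext_entry fun g h => ContinuousLinearMap.ext fun v => ?_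
    have h1 := DFunLike.congr_fun (hT g h) v
    simpa [mul_apply_eq_comp, amplify_single] using h1

variable [Group G]

theorem translation_single (k h : G) (v : H) :
    translation k (single h v) = single (k * h) v := by
  ext g
  rw [translation_apply]
  rcases eq_or_ne g (k * h) with rfl | hg
  · rw [inv_mul_cancel_left, single_apply_self, single_apply_self]
  · rw [single_apply_of_ne hg, single_apply_of_ne]
    rwa [Ne, inv_mul_eq_iff_eq_mul]

theorem translation_mul (g h : G) :
    (translation (g * h) : ell2 G H →L[ℂ] ell2 G H) = translation g * translation h := by
  ext ξ k
  simp [mul_apply_eq_comp, mul_assoc]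

theorem translation_one : (translation (1 : G) : ell2 G H →L[ℂ] ell2 G H) = 1 := by
  ext ξ k
  simp

theorem star_translation [CompleteSpace H] (g : G) :
    star (translation g : ell2 G H →L[ℂ] ell2 G H) = translation g⁻¹ := by
  rw [ContinuousLinearMap.star_eq_adjoint, eq_comm, ContinuousLinearMap.eq_adjoint_iff]
  intro ξ η
  rw [lp.inner_eq_tsum, lp.inner_eq_tsum,
    ← (Equiv.mulLeft g).tsum_eq fun i => ⟪ξ i, (translation g η : ell2 G H) i⟫_ℂ]
  simp

/-- The operator `(ξ_g)_g ↦ (t ξ_{g k})_g` on `ℓ²(G, H)`. -/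
def rightShift (t : H →L[ℂ] H) (k : G) : ell2 G H →L[ℂ] ell2 G H :=
  amplify G t ∘L LinearMap.mkContinuous
    { toFun := fun ξ => (⟨fun g => ξ (g * k),
        (memℓp_gen_iff (by norm_num)).2 <|
          ((Equiv.mulRight k).summable_iff (f := fun g => ‖ξ g‖ ^ (2 : ENNReal).toReal)).2 <|
            (memℓp_gen_iff (by norm_num)).1 (lp.memℓp ξ)⟩ : ell2 G H)
      map_add' := fun ξ η => rfl
      map_smul' := fun c ξ => rfl }
    1 fun ξ => by
      rw [one_mul, lp.norm_eq_tsum_rpow (by norm_num), lp.norm_eq_tsum_rpow (by norm_num)]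
      exact le_of_eq <| congrArg (fun t : ℝ => t ^ (1 / (2 : ENNReal).toReal)) <|
        (Equiv.mulRight k).tsum_eq fun g => ‖ξ g‖ ^ (2 : ENNReal).toReal

@[simp]
theorem rightShift_apply (t : H →L[ℂ] H) (k : G) (ξ : ell2 G H) (g : G) :
    rightShift t k ξ g = t (ξ (g * k)) := rfl

theorem rightShift_single (t : H →L[ℂ] H) (k h : G) (v : H) :
    rightShift t k (single (h * k) v) = single h (t v) := by
  ext g
  rw [rightShift_apply]
  rcases eq_or_ne g h with rfl | hg
  · rw [single_apply_self, single_apply_self]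
  · rw [single_apply_of_ne hg, single_apply_of_ne, map_zero]
    rwa [Ne, mul_left_inj]

end Entries

/-! ### Matrix entries of elements of the crossed product -/

section CrossedProduct

variable {H : Type*} [NormedAddCommGroup H] [InnerProductSpace ℂ H] [CompleteSpace H]
  {G : Type*} [Group G] (N : VonNeumannAlgebra H)
  (α : G →* (N.toStarSubalgebra ≃⋆ₐ[ℂ] N.toStarSubalgebra))

theorem subset_generatedVN (S : Set (H →L[ℂ] H)) : S ⊆ generatedVN S := by
  intro x hx
  refine (StarSubalgebra.mem_centralizer_iff ℂ).2 fun y hy => ?_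
  have h := (StarSubalgebra.mem_centralizer_iff ℂ).1 hy x hx
  refine ⟨h.1.symm, ?_⟩
  have := congrArg star h.2
  simpa using this

theorem isVonNeumann_centralizer (S : Set (H →L[ℂ] H)) :
    IsVonNeumann (StarSubalgebra.centralizer ℂ S) := by
  rw [IsVonNeumann, StarSubalgebra.coe_centralizer]
  exact Set.centralizer_centralizer_centralizer _

theorem isVonNeumann_inf {A B : StarSubalgebra ℂ (H →L[ℂ] H)} (hA : IsVonNeumann A)
    (hB : IsVonNeumann B) : IsVonNeumann (A ⊓ B) := by
  refine subset_antisymm (fun x hx => ⟨?_, ?_⟩) Set.subset_centralizer_centralizer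
  · rw [← hA]
    exact Set.centralizer_subset (Set.centralizer_subset fun y hy => hy.1) hx
  · rw [← hB]
    exact Set.centralizer_subset (Set.centralizer_subset fun y hy => hy.2) hx

theorem isVonNeumann_crossedProduct : IsVonNeumann (crossedProduct N α) :=
  isVonNeumann_centralizer _

theorem rep_mem (x : N.toStarSubalgebra) : rep N α x ∈ crossedProduct N α :=
  subset_generatedVN _ (Or.inl ⟨x, rfl⟩)

theorem translation_mem (g : G) : translation g ∈ crossedProduct N α :=
  subset_generatedVN _ (Or.inr ⟨g, rfl⟩)

theorem rep_single (x : N.toStarSubalgebra) (g : G) (v : H) :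
    rep N α x (single g v) = single g ((α g⁻¹ x : H →L[ℂ] H) v) :=
  diagonal_single (fun g => (α g⁻¹ x : H →L[ℂ] H)) ‖(x : H →L[ℂ] H)‖
    (fun g => norm_aut_apply_le N (α g⁻¹) x) g v

theorem entry_rep_self (x : N.toStarSubalgebra) (g : G) :
    entry (rep N α x) g g = α g⁻¹ x :=
  entry_diagonal_self (fun g => (α g⁻¹ x : H →L[ℂ] H)) ‖(x : H →L[ℂ] H)‖
    (fun g => norm_aut_apply_le N (α g⁻¹) x) g

theorem entry_rep_of_ne (x : N.toStarSubalgebra) {g h : G} (hgh : g ≠ h) :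
    entry (rep N α x) g h = 0 :=
  entry_diagonal_of_ne (fun g => (α g⁻¹ x : H →L[ℂ] H)) ‖(x : H →L[ℂ] H)‖
    (fun g => norm_aut_apply_le N (α g⁻¹) x) hgh

theorem rep_injective : Function.Injective (rep N α) := by
  intro x y hxy
  have := congrArg (fun T => entry T 1 1) hxy
  simp only [entry_rep_self, inv_one, map_one] at this
  exact Subtype.ext this

/-- The covariance relation. -/
theorem translation_mul_rep (g : G) (x : N.toStarSubalgebra) :
    translation g * rep N α x = rep N α (α g x) * translation g := by
  ext ξ h
  simp [mul_apply_eq_comp, mul_inv_rev, map_mul]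

/-- Operators commuting with the generators commute with the whole crossed product. -/
theorem mem_commutant_crossedProduct {T m : ell2 G H →L[ℂ] ell2 G H}
    (hrep : ∀ x, rep N α x * T = T * rep N α x)
    (htr : ∀ g, translation g * T = T * translation g) (hm : m ∈ crossedProduct N α) :
    m * T = T * m := by
  have hT : T ∈ StarSubalgebra.centralizer ℂ (Set.range (rep N α) ∪ Set.range translation) := by
    rw [StarSubalgebra.mem_centralizer_iff]
    rintro _ (⟨x, rfl⟩ | ⟨g, rfl⟩)
    · exact ⟨hrep x, by rw [← map_star]; exact hrep _⟩
    · exact ⟨htr g, by rw [star_translation]; exact htr _⟩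
  exact (((StarSubalgebra.mem_centralizer_iff ℂ).1 hm) T hT).1.symm

/-- Elements of the crossed product commute with `1 ⊗ N'`, so their entries lie in `N'' = N`. -/
theorem entry_mem {m : ell2 G H →L[ℂ] ell2 G H} (hm : m ∈ crossedProduct N α) (g h : G) :
    entry m g h ∈ N.toStarSubalgebra := by
  rw [← VonNeumannAlgebra.commutant_commutant N]
  refine VonNeumannAlgebra.mem_commutant_iff.2 fun y hy => ?_
  have hy' := VonNeumannAlgebra.mem_commutant_iff.1 hy
  have h1 : m * amplify G y = amplify G y * m := by
    refine mem_commutant_crossedProduct N α (fun x => ?_) (fun k => ?_) hm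
    · ext ξ k
      exact DFunLike.congr_fun (hy' _ (α k⁻¹ x).2) (ξ k)
    · ext ξ k
      simp [mul_apply_eq_comp]
  exact (amplify_commute_iff.1 h1 g h).symm

/-- The entry at `(g k, h k)` of an element of the crossed product is the entry at `(g, h)` moved by
`α k⁻¹`: the element commutes with `rightShift t k` for each intertwiner `t` of `α k⁻¹` with the
identity, and these intertwiners separate vectors. -/
theorem entry_mul_right {m : ell2 G H →L[ℂ] ell2 G H} (hm : m ∈ crossedProduct N α) (g h k : G) :
    entry m (g * k) (h * k) = α k⁻¹ ⟨entry m g h, entry_mem N α hm g h⟩ := by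
  ext v
  by_contra hne
  obtain ⟨t, ht, ht0⟩ := exists_intertwiner (α k⁻¹) (sub_ne_zero.2 hne)
  have hcomm : m * rightShift t k = rightShift t k * m := by
    refine mem_commutant_crossedProduct N α (fun x => ?_) (fun l => ?_) hm
    · ext ξ l
      have h1 := DFunLike.congr_fun (ht (α l⁻¹ x)) (ξ (l * k))
      simp only [mul_apply_eq_comp, rightShift_apply, rep_apply, mul_inv_rev, map_mul] at h1 ⊢
      exact h1.symm
    · ext ξ l
      simp [mul_apply_eq_comp, mul_assoc]
  have h2 := congrArg (fun ξ : ell2 G H => ξ g) (DFunLike.congr_fun hcomm (single (h * k) v))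
  simp only [mul_apply_eq_comp, rightShift_apply, rightShift_single] at h2
  have h3 := DFunLike.congr_fun (ht ⟨entry m g h, entry_mem N α hm g h⟩) v
  simp only [mul_apply_eq_comp, entry_apply] at h3
  rw [map_sub, entry_apply, h3, h2, sub_self] at ht0
  exact ht0 rfl

/-- The Fourier coefficient of `m` at the identity of `G`, read off the matrix entry at `(1, 1)`. -/
def coefficient (m : crossedProduct N α) : N.toStarSubalgebra :=
  ⟨entry m.1 1 1, entry_mem N α m.2 1 1⟩

theorem entry_self (m : crossedProduct N α) (g : G) :
    entry m.1 g g = α g⁻¹ (coefficient N α m) := by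
  have h := entry_mul_right N α m.2 1 1 g
  rwa [one_mul] at h

/-- An element of the crossed product whose Fourier coefficients vanish off the identity of `G` lies
in the copy of `N`. -/
theorem eq_rep_of_entry_eq_zero (m : crossedProduct N α) (h : ∀ g ≠ 1, entry m.1 g 1 = 0) :
    m.1 = rep N α (coefficient N α m) := by
  refine ext_entry fun g k => ?_
  rcases eq_or_ne g k with rfl | hgk
  · rw [entry_self, entry_rep_self]
  · rw [entry_rep_of_ne _ _ _ hgk]
    have h1 := entry_mul_right N α m.2 (g * k⁻¹) 1 k
    rw [inv_mul_cancel_right, one_mul] at h1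
    rw [h1, ZeroMemClass.coe_eq_zero, EmbeddingLike.map_eq_zero_iff]
    exact Subtype.ext (h _ fun h2 => hgk (mul_inv_eq_one.1 h2))

end CrossedProduct

/-! ### Proper outerness on the center -/

section Center

variable {H : Type*} [NormedAddCommGroup H] [InnerProductSpace ℂ H] [CompleteSpace H]
  {N : VonNeumannAlgebra H}

theorem mem_center_iff {A : Type*} [Ring A] [StarRing A] [Algebra ℂ A] [StarModule ℂ A] {x : A} :
    x ∈ center A ↔ ∀ y, y * x = x * y :=
  Subalgebra.mem_center_iff (R := ℂ)

/-- The central support `z` of `b`: the projection onto the closed span of `N b H`, which is invariant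
under both `N` and `N'`. -/
theorem exists_central_support (b : N.toStarSubalgebra) :
    ∃ z : N.toStarSubalgebra, IsStarProjection z ∧ z ∈ center N.toStarSubalgebra ∧ z * b = b ∧
      ∀ x : N.toStarSubalgebra, (∀ n : N.toStarSubalgebra, x * (n * b) = 0) → x * z = 0 := by
  set K : Submodule ℂ H := (⨆ n : N.toStarSubalgebra,
    LinearMap.range ((n * b : N.toStarSubalgebra) : H →L[ℂ] H).toLinearMap).topologicalClosure
    with hK
  have hgen : ∀ (n : N.toStarSubalgebra) v, ((n * b : N.toStarSubalgebra) : H →L[ℂ] H) v ∈ K :=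
    fun n v => Submodule.le_topologicalClosure _ (Submodule.mem_iSup_of_mem n ⟨v, rfl⟩)
  have hmin : ∀ x : H →L[ℂ] H,
      (∀ (n : N.toStarSubalgebra) v, x (((n * b : N.toStarSubalgebra) : H →L[ℂ] H) v) ∈ K) →
        ∀ v ∈ K, x v ∈ K := by
    intro x hx
    have : K ≤ K.comap x.toLinearMap := by
      refine Submodule.topologicalClosure_minimal _ (iSup_le fun n => ?_) ?_
      · rintro _ ⟨v, rfl⟩
        exact hx n v
      · exact (Submodule.isClosed_topologicalClosure _).preimage x.continuous
    exact this
  have h1 : K.starProjection ∈ N := by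
    refine starProjection_mem N fun y hy => hmin y fun n v => ?_
    have := DFunLike.congr_fun (VonNeumannAlgebra.mem_commutant_iff.1 hy _ (n * b).2) v
    rw [mul_apply_eq_comp, mul_apply_eq_comp] at this
    rw [← this]
    exact hgen n _
  have h2 : K.starProjection ∈ N.commutant := by
    refine starProjection_mem N.commutant fun y hy => hmin y fun n v => ?_
    rw [VonNeumannAlgebra.commutant_commutant] at hy
    have := hgen (⟨y, hy⟩ * n) v
    rw [mul_assoc] at this
    exact this
  refine ⟨⟨K.starProjection, h1⟩, isStarProjection_coe_iff.1 isStarProjection_starProjection,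
    mem_center_iff.2 fun y => Subtype.ext (VonNeumannAlgebra.mem_commutant_iff.1 h2 y y.2),
    Subtype.ext (ContinuousLinearMap.ext fun v => ?_), fun x hx => ?_⟩
  · refine Submodule.starProjection_eq_self_iff.2 ?_
    have := hgen 1 v
    rwa [one_mul] at this
  · have hKx : K ≤ LinearMap.ker (x : H →L[ℂ] H).toLinearMap := by
      refine Submodule.topologicalClosure_minimal _ (iSup_le fun n => ?_)
        (ContinuousLinearMap.isClosed_ker _)
      rintro _ ⟨v, rfl⟩
      exact DFunLike.congr_fun (congrArg Subtype.val (hx n)) v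
    exact Subtype.ext (ContinuousLinearMap.ext fun v =>
      hKx (Submodule.starProjection_apply_mem K v))

/-- If `θ` is properly outer on the center, a solution `b` of `b d = θ d b` for all central `d` is
zero: `θ` fixes the center pointwise below the central support of `b`. -/
theorem eq_zero_of_twisted_commute {θ : N.toStarSubalgebra ≃⋆ₐ[ℂ] N.toStarSubalgebra}
    (hθ : IsProperlyOuter (restrictCenter θ)) {b : N.toStarSubalgebra}
    (hb : ∀ d ∈ center N.toStarSubalgebra, b * d = θ d * b) : b = 0 := by
  obtain ⟨z, hz, hzc, hzb, hzx⟩ := exists_central_support b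
  have key : ∀ d ∈ center N.toStarSubalgebra, θ d * z = d * z := by
    intro d hd
    rw [← sub_eq_zero, ← sub_mul]
    refine hzx _ fun n => ?_
    have h1 := mem_center_iff.1 (map_mem_center θ hd) n
    have h2 := mem_center_iff.1 hd
    rw [sub_mul, ← mul_assoc, ← h1, mul_assoc, ← hb d hd, ← h2 (n * b), mul_assoc, sub_self]
  -- `key` at `z` gives `z ≤ θ z`, and at `θ⁻¹ z` it gives `θ z ≤ z`
  have hθz : θ z = z := by
    have h1 : θ z * z = z := by rw [key z hzc, hz.isIdempotentElem.eq]
    have h2 : z * θ.symm z = z := by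
      have h := key _ (map_mem_center θ.symm hzc)
      rw [θ.apply_symm_apply, hz.isIdempotentElem.eq] at h
      rw [mem_center_iff.1 (map_mem_center θ.symm hzc), ← h]
    have h3 := congrArg θ h2
    rw [map_mul, θ.apply_symm_apply] at h3
    rw [← h3, h1]
  have h0 := hθ ⟨z, hzc⟩ ⟨Subtype.ext hz.isIdempotentElem, Subtype.ext hz.isSelfAdjoint⟩
    (Semigroup.mem_center_iff.2 fun y => Subtype.ext (mem_center_iff.1 hzc y)) ⟨⟨z, hzc⟩, Subtype.ext ?_, Subtype.ext ?_, fun x => Subtype.ext ?_⟩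
  · rw [← hzb, show z = 0 from congrArg Subtype.val h0, zero_mul]
  · change star z * z = z
    rw [hz.isSelfAdjoint.star_eq, hz.isIdempotentElem.eq]
  · change z * star z = z
    rw [hz.isSelfAdjoint.star_eq, hz.isIdempotentElem.eq]
  · change θ (x * z) = z * (x * z) * star z
    rw [map_mul, hθz, key x x.2, hz.isSelfAdjoint.star_eq, ← mul_assoc,
      mem_center_iff.1 x.2 z, mul_assoc, mul_assoc, hz.isIdempotentElem.eq,
      hz.isIdempotentElem.eq]

end Center

/-! ### The relative commutant of the center in the crossed product -/

section RelativeCommutant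

variable {H : Type*} [NormedAddCommGroup H] [InnerProductSpace ℂ H] [CompleteSpace H]
  {G : Type*} [Group G] (N : VonNeumannAlgebra H)
  (α : G →* (N.toStarSubalgebra ≃⋆ₐ[ℂ] N.toStarSubalgebra))

theorem copyOfAlgebra_le : copyOfAlgebra N α ≤ crossedProduct N α := by
  rintro _ ⟨x, rfl⟩
  exact rep_mem N α x

theorem copyOfCenter_le : copyOfCenter N α ≤ copyOfAlgebra N α := by
  rintro _ ⟨x, -, rfl⟩
  exact ⟨x, rfl⟩

/-- If the action on the center is properly outer, the copy of `N` is the relative commutant of the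
copy of its center in the crossed product. -/
theorem mem_copyOfAlgebra_iff_commute
    (hα : ∀ g : G, g ≠ 1 → IsProperlyOuter (restrictCenter (α g)))
    (m : ell2 G H →L[ℂ] ell2 G H) : m ∈ copyOfAlgebra N α ↔
      m ∈ crossedProduct N α ∧ ∀ x ∈ copyOfCenter N α, x * m = m * x := by
  constructor
  · rintro ⟨x, rfl⟩
    refine ⟨rep_mem N α x, ?_⟩
    rintro _ ⟨d, hd, rfl⟩
    have := congrArg (rep N α) (mem_center_iff.1 hd x)
    rw [map_mul, map_mul] at this
    exact this.symm
  · rintro ⟨hm, hc⟩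
    refine ⟨_, (eq_rep_of_entry_eq_zero N α ⟨m, hm⟩ fun g hg => ?_).symm⟩
    have h1 := eq_zero_of_twisted_commute (hα g⁻¹ (inv_ne_one.2 hg))
      (b := ⟨entry m g 1, entry_mem N α hm g 1⟩) fun d hd => ?_
    · exact congrArg Subtype.val h1
    · refine Subtype.ext (ContinuousLinearMap.ext fun v => ?_)
      have h2 := congrArg (fun ξ : ell2 G H => ξ g)
        (DFunLike.congr_fun (hc _ ⟨d, hd, rfl⟩) (single 1 v))
      simp only [mul_apply_eq_comp] at h2
      erw [rep_apply, rep_single] at h2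
      rw [inv_one, map_one] at h2
      exact h2.symm

theorem isVonNeumann_copyOfAlgebra
    (hα : ∀ g : G, g ≠ 1 → IsProperlyOuter (restrictCenter (α g))) :
    IsVonNeumann (copyOfAlgebra N α) := by
  have : copyOfAlgebra N α = crossedProduct N α ⊓
      StarSubalgebra.centralizer ℂ (copyOfCenter N α : Set (ell2 G H →L[ℂ] ell2 G H)) := by
    ext m
    rw [mem_copyOfAlgebra_iff_commute N α hα, StarSubalgebra.mem_inf,
      StarSubalgebra.mem_centralizer_iff]
    exact and_congr_right fun _ => ⟨fun h x hx => ⟨h x hx, h _ (star_mem hx)⟩, fun h x hx => (h x hx).1⟩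
  rw [this]
  exact isVonNeumann_inf (isVonNeumann_crossedProduct N α) (isVonNeumann_centralizer _)

theorem isVonNeumann_copyOfCenter (hN : IsVonNeumann (copyOfAlgebra N α)) :
    IsVonNeumann (copyOfCenter N α) := by
  have : copyOfCenter N α = copyOfAlgebra N α ⊓
      StarSubalgebra.centralizer ℂ (copyOfAlgebra N α : Set (ell2 G H →L[ℂ] ell2 G H)) := by
    ext m
    rw [StarSubalgebra.mem_inf, StarSubalgebra.mem_centralizer_iff]
    constructor
    · rintro ⟨d, hd, rfl⟩
      have : ∀ x, rep N α x * rep N α d = rep N α d * rep N α x := fun x => by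
        rw [← map_mul, ← map_mul, mem_center_iff.1 hd x]
      refine ⟨⟨d, rfl⟩, ?_⟩
      rintro _ ⟨x, rfl⟩
      exact ⟨this x, by have := this (star x); rwa [map_star] at this⟩
    · rintro ⟨⟨d, rfl⟩, hd⟩
      refine ⟨d, mem_center_iff.2 fun y => rep_injective N α ?_, rfl⟩
      rw [map_mul, map_mul]
      exact (hd _ ⟨y, rfl⟩).1
  rw [this]
  exact isVonNeumann_inf hN (isVonNeumann_centralizer _)

/-- If the relative commutant of the copy of the center is contained in the copy of `N`, the action
on the center is properly outer: when `α g` is inner on the corner of the center under `z`, hence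
trivial there by commutativity, `π(z) λ_g` commutes with the center, but it has no diagonal
entries. -/
theorem isProperlyOuter_restrictCenter
    (h : ∀ m : ell2 G H →L[ℂ] ell2 G H, m ∈ crossedProduct N α →
      (∀ x ∈ copyOfCenter N α, x * m = m * x) → m ∈ copyOfAlgebra N α)
    {g : G} (hg : g ≠ 1) : IsProperlyOuter (restrictCenter (α g)) := by
  rintro ⟨z, hzc⟩ hz - ⟨⟨u, huc⟩, hu1, hu2, hu⟩
  have hzz : z * z = z := congrArg Subtype.val hz.isIdempotentElem
  have huu : u * star u = z := congrArg Subtype.val hu2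
  -- `α g` is the identity on the center of `N z`
  have hfix : ∀ x ∈ center N.toStarSubalgebra, α g (x * z) = x * z := by
    intro x hx
    have h1 : α g (x * z) = u * (x * z) * star u := congrArg Subtype.val (hu ⟨x, hx⟩)
    rw [h1, ← mem_center_iff.1 huc, mul_assoc, huu, mul_assoc, hzz]
  have hmem : rep N α z * translation g ∈ copyOfAlgebra N α := by
    refine h _ (mul_mem (rep_mem N α z) (translation_mem N α g)) ?_
    rintro _ ⟨d, hd, rfl⟩
    have h1 : z * α g d = d * z := by
      have hz1 := hfix 1 (one_mem _)
      rw [one_mul] at hz1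
      rw [mem_center_iff.1 (map_mem_center (α g) hd), ← hfix d hd, map_mul, hz1]
    change rep N α d * _ = _ * rep N α d
    rw [mul_assoc, translation_mul_rep, ← mul_assoc, ← mul_assoc, ← map_mul, ← map_mul, h1]
  obtain ⟨n, hn⟩ := hmem
  refine Subtype.ext (Subtype.ext (ContinuousLinearMap.ext fun v => ?_))
  have h1 := congrArg (fun T => entry T 1 g⁻¹ v) hn
  have h2 : entry (rep N α n) 1 g⁻¹ = 0 := entry_rep_of_ne N α n (inv_ne_one.2 hg).symm
  have h3 : entry (rep N α z * translation g) 1 g⁻¹ v = (z : H →L[ℂ] H) v := by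
    rw [entry_apply, mul_apply_eq_comp, translation_single, mul_inv_cancel, rep_apply,
      single_apply_self, inv_one, map_one]
    rfl
  change entry (rep N α n) 1 g⁻¹ v = _ at h1
  rw [h2, h3] at h1
  exact h1.symm

end RelativeCommutant

/-! ### Least upper bounds and weak limits -/

section WeakLimits

variable {H : Type*} [NormedAddCommGroup H] [InnerProductSpace ℂ H]

theorem nonneg_iff_inner {T : H →L[ℂ] H} :
    0 ≤ T ↔ ∀ v, 0 ≤ (⟪v, T v⟫_ℂ).re ∧ (⟪v, T v⟫_ℂ).im = 0 := by
  rw [ContinuousLinearMap.nonneg_iff_isPositive, ContinuousLinearMap.isPositive_iff_complex]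
  refine forall_congr' fun v => ?_
  rw [← inner_conj_symm (T v) v, Complex.ext_iff]
  simp [-inner_conj_symm, and_comm, eq_comm]

variable [CompleteSpace H]

/-- Bounded families of operators have weak operator limits along ultrafilters. -/
theorem exists_weak_limit {ι : Type*} (U : Ultrafilter ι) (x : ι → H →L[ℂ] H) {R : ℝ}
    (hx : ∀ᶠ i in (U : Filter ι), ‖x i‖ ≤ R) :
    ∃ T : H →L[ℂ] H, ∀ v w, Tendsto (fun i => ⟪v, x i w⟫_ℂ) U (𝓝 ⟪v, T w⟫_ℂ) := by
  have hbd : ∀ v w, ∀ᶠ i in (U : Filter ι), ‖⟪v, x i w⟫_ℂ‖ ≤ R * ‖v‖ * ‖w‖ := by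
    intro v w
    filter_upwards [hx] with i hi
    calc _ ≤ ‖v‖ * ‖x i w‖ := norm_inner_le_norm _ _
      _ ≤ ‖v‖ * (R * ‖w‖) := by gcongr; exact (x i).le_of_opNorm_le hi w
      _ = _ := by ring
  have hlim : ∀ v w, ∃ c, Tendsto (fun i => ⟪v, x i w⟫_ℂ) U (𝓝 c) := by
    intro v w
    obtain ⟨c, -, hc⟩ := (isCompact_closedBall (0 : ℂ) (R * ‖v‖ * ‖w‖)).ultrafilter_le_nhds
      (U.map fun i => ⟪v, x i w⟫_ℂ) (by
        rw [le_principal_iff]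
        change ∀ᶠ i in (U : Filter ι), ⟪v, x i w⟫_ℂ ∈ Metric.closedBall 0 _
        simpa using hbd v w)
    exact ⟨c, hc⟩
  choose L hL using hlim
  have hLn : ∀ v w, ‖L v w‖ ≤ R * ‖v‖ * ‖w‖ := fun v w =>
    le_of_tendsto (hL v w).norm (hbd v w)
  let B : H →L⋆[ℂ] H →L[ℂ] ℂ := LinearMap.mkContinuous₂
    (LinearMap.mk₂'ₛₗ (starRingEnd ℂ) (RingHom.id ℂ) L
      (fun v v' w => tendsto_nhds_unique (hL _ _)
        (((hL v w).add (hL v' w)).congr fun i => (inner_add_left _ _ _).symm))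
      (fun c v w => tendsto_nhds_unique (hL _ _)
        (((hL v w).const_mul _).congr fun i => (inner_smul_left _ _ _).symm))
      (fun v w w' => tendsto_nhds_unique (hL _ _)
        (((hL v w).add (hL v w')).congr fun i => by rw [map_add, inner_add_right]))
      (fun c v w => tendsto_nhds_unique (hL _ _)
        (((hL v w).const_mul _).congr fun i => by rw [map_smul, inner_smul_right]; rfl))) R hLn
  refine ⟨star (InnerProductSpace.continuousLinearMapOfBilin B), fun v w => ?_⟩
  rw [ContinuousLinearMap.star_eq_adjoint, ContinuousLinearMap.adjoint_inner_right,
    InnerProductSpace.continuousLinearMapOfBilin_apply]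
  exact hL v w

/-- A least upper bound of a directed set in a von Neumann algebra is its weak limit, in the form
that upper bounds of the quadratic forms pass to it. A weak cluster point of the set lies in the
algebra and is an upper bound, so it dominates the least upper bound. -/
theorem re_inner_le_of_isLUB {A : StarSubalgebra ℂ (H →L[ℂ] H)} (hA : IsVonNeumann A)
    {d : Set A} (hne : d.Nonempty) (hdir : DirectedOn (· ≤ ·) d) {a : A} (ha : IsLUB d a)
    {v : H} {c : ℝ} (hc : ∀ x ∈ d, (⟪v, (x : H →L[ℂ] H) v⟫_ℂ).re ≤ c) :
    (⟪v, (a : H →L[ℂ] H) v⟫_ℂ).re ≤ c := by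
  obtain ⟨x₀, hx₀⟩ := hne
  have : Nonempty d := ⟨⟨x₀, hx₀⟩⟩
  have : IsDirectedOrder d := ⟨fun x y => by
    obtain ⟨z, hz, hxz, hyz⟩ := hdir x x.2 y y.2
    exact ⟨⟨z, hz⟩, hxz, hyz⟩⟩
  let U : Ultrafilter d := Ultrafilter.of atTop
  have hU : ∀ x : d, ∀ᶠ y in (U : Filter d), x ≤ y := fun x =>
    Ultrafilter.of_le atTop (eventually_ge_atTop x)
  obtain ⟨T, hT⟩ := exists_weak_limit U (fun x : d => ((x : A) : H →L[ℂ] H))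
    (R := ‖(a : H →L[ℂ] H) - (x₀ : H →L[ℂ] H)‖ + ‖(x₀ : H →L[ℂ] H)‖) (by
      filter_upwards [hU ⟨x₀, hx₀⟩] with y hy
      have h1 : (0 : H →L[ℂ] H) ≤ ((y : A) : H →L[ℂ] H) - (x₀ : H →L[ℂ] H) := sub_nonneg.2 hy
      have h2 : ((y : A) : H →L[ℂ] H) - (x₀ : H →L[ℂ] H) ≤ (a : H →L[ℂ] H) - (x₀ : H →L[ℂ] H) :=
        sub_le_sub_right (show ((y : A) : H →L[ℂ] H) ≤ a from ha.1 y.2) _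
      have h3 := CStarAlgebra.norm_le_norm_of_nonneg_of_le h1 h2
      have h4 := norm_le_norm_sub_add ((y : A) : H →L[ℂ] H) (x₀ : H →L[ℂ] H)
      linarith)
  have hTA : T ∈ A := by
    rw [← SetLike.mem_coe, ← hA]
    intro y hy
    refine ContinuousLinearMap.ext fun w => ext_inner_left ℂ fun u => ?_
    rw [mul_apply_eq_comp, mul_apply_eq_comp, ← ContinuousLinearMap.adjoint_inner_left]
    refine tendsto_nhds_unique (hT _ _) ((hT u (y w)).congr fun x => ?_)
    rw [ContinuousLinearMap.adjoint_inner_left, ← mul_apply_eq_comp, ← mul_apply_eq_comp,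
      hy _ (x : A).2]
  have hub : (⟨T, hTA⟩ : A) ∈ upperBounds d := by
    intro x hx
    change (x : H →L[ℂ] H) ≤ T
    rw [← sub_nonneg, nonneg_iff_inner]
    intro w
    have h1 := (hT w w).sub_const ⟪w, (x : H →L[ℂ] H) w⟫_ℂ
    have h2 : ∀ᶠ y : d in (U : Filter d),
        0 ≤ (⟪w, ((y : A) : H →L[ℂ] H) w⟫_ℂ - ⟪w, (x : H →L[ℂ] H) w⟫_ℂ).re ∧
        (⟪w, ((y : A) : H →L[ℂ] H) w⟫_ℂ - ⟪w, (x : H →L[ℂ] H) w⟫_ℂ).im = 0 := by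
      filter_upwards [hU ⟨x, hx⟩] with y hy
      have h3 : (0 : H →L[ℂ] H) ≤ ((y : A) : H →L[ℂ] H) - (x : H →L[ℂ] H) := sub_nonneg.2 hy
      rw [← inner_sub_right]
      exact nonneg_iff_inner.1 h3 w
    rw [sub_apply, inner_sub_right]
    exact ⟨ge_of_tendsto ((Complex.continuous_re.tendsto _).comp h1) (h2.mono fun y h => h.1),
      tendsto_nhds_unique ((Complex.continuous_im.tendsto _).comp h1)
        (tendsto_const_nhds.congr' (h2.mono fun y h => h.2.symm))⟩
  have haT : (a : H →L[ℂ] H) ≤ T := ha.2 hub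
  have h4 := (nonneg_iff_inner.1 (sub_nonneg.2 haT) v).1
  rw [sub_apply, inner_sub_right, Complex.sub_re] at h4
  have h5 : (⟪v, T v⟫_ℂ).re ≤ c :=
    le_of_tendsto' ((Complex.continuous_re.tendsto _).comp (hT v v)) fun x => hc x x.2
  linarith

end WeakLimits

/-! ### The conditional expectation -/

section CondExp

variable {H : Type*} [NormedAddCommGroup H] [InnerProductSpace ℂ H]

theorem entry_sub {G : Type*} (S T : ell2 G H →L[ℂ] ell2 G H) (g h : G) :
    entry (S - T) g h = entry S g h - entry T g h := by
  ext v
  simp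

theorem entry_nonneg [CompleteSpace H] {G : Type*} {T : ell2 G H →L[ℂ] ell2 G H} (hT : 0 ≤ T) (g : G) : 0 ≤ entry T g g := by
  rw [nonneg_iff_inner] at hT ⊢
  intro v
  rw [inner_entry]
  exact hT _

variable [CompleteSpace H]
  {G : Type*} [Group G] (N : VonNeumannAlgebra H)
  (α : G →* (N.toStarSubalgebra ≃⋆ₐ[ℂ] N.toStarSubalgebra))

theorem rep_nonneg {x : N.toStarSubalgebra} (hx : ∀ g, 0 ≤ (α g x : H →L[ℂ] H)) :
    0 ≤ rep N α x := by
  rw [nonneg_iff_inner]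
  intro ξ
  have h := lp.hasSum_inner (𝕜 := ℂ) (G := fun _ : G => H) ξ (rep N α x ξ)
  have hre := Complex.hasSum_re h
  have him := Complex.hasSum_im h
  refine ⟨hre.nonneg fun g => (nonneg_iff_inner.1 (hx g⁻¹) (ξ g)).1, ?_⟩
  refine him.unique ?_
  convert hasSum_zero with g
  exact (nonneg_iff_inner.1 (hx g⁻¹) (ξ g)).2

/-- The canonical conditional expectation of the crossed product onto the copy of `N`, which sends
`m` to the image of its Fourier coefficient at the identity. As an operator matrix it is the diagonal
part of `m`. -/
def condExp : crossedProduct N α →ₗ[ℂ] copyOfAlgebra N α where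
  toFun m := ⟨rep N α (coefficient N α m), ⟨_, rfl⟩⟩
  map_add' m m' := Subtype.ext <| by
    change rep N α _ = rep N α _ + rep N α _
    rw [← map_add]
    exact congrArg (rep N α) (Subtype.ext (ContinuousLinearMap.ext fun v => rfl))
  map_smul' c m := Subtype.ext <| by
    change rep N α _ = c • rep N α _
    rw [← map_smul]
    exact congrArg (rep N α) (Subtype.ext (ContinuousLinearMap.ext fun v => rfl))

theorem coe_condExp (m : crossedProduct N α) :
    (condExp N α m : ell2 G H →L[ℂ] ell2 G H) = rep N α (coefficient N α m) := rfl

theorem condExp_nonneg {m : crossedProduct N α} (hm : 0 ≤ (m : ell2 G H →L[ℂ] ell2 G H)) :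
    0 ≤ (condExp N α m : ell2 G H →L[ℂ] ell2 G H) := by
  refine rep_nonneg N α fun g => ?_
  have := entry_self N α m g⁻¹
  rw [inv_inv] at this
  rw [← this]
  exact entry_nonneg hm _

theorem condExp_mono : Monotone (condExp N α) := by
  intro m m' h
  have h1 : 0 ≤ ((m' - m : crossedProduct N α) : ell2 G H →L[ℂ] ell2 G H) :=
    sub_nonneg.2 (show (m : ell2 G H →L[ℂ] ell2 G H) ≤ m' from h)
  have h2 := condExp_nonneg N α h1
  rw [map_sub] at h2
  exact sub_nonneg.1 h2

theorem scottContinuous_condExp : ScottContinuous (condExp N α) := by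
  intro d hne hdir a ha
  refine ⟨(condExp_mono N α).mem_upperBounds_image ha.1, ?_⟩
  rintro ⟨_, n, rfl⟩ hb
  obtain ⟨x₀, hx₀⟩ := id hne
  have hub : ∀ x ∈ d, ∀ g, 0 ≤ (α g n : H →L[ℂ] H) - entry x.1 g⁻¹ g⁻¹ := by
    intro x hx g
    have h1 : (condExp N α x : ell2 G H →L[ℂ] ell2 G H) ≤ rep N α n := hb ⟨x, hx, rfl⟩
    have h2 := entry_nonneg (sub_nonneg.2 h1) g⁻¹
    rwa [entry_sub, coe_condExp, entry_rep_self, entry_rep_self, ← entry_self, inv_inv] at h2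
  have hkey : 0 ≤ rep N α (n - coefficient N α a) := by
    refine rep_nonneg N α fun g => ?_
    have h1 : ((α g (n - coefficient N α a) : N.toStarSubalgebra) : H →L[ℂ] H) =
        (α g n : H →L[ℂ] H) - entry a.1 g⁻¹ g⁻¹ := by
      rw [entry_self, inv_inv, map_sub]
      rfl
    rw [h1, nonneg_iff_re_inner]
    constructor
    · have h2 : (0 : ell2 G H →L[ℂ] ell2 G H) ≤ a.1 - x₀.1 :=
        sub_nonneg.2 (show (x₀ : ell2 G H →L[ℂ] ell2 G H) ≤ a from ha.1 hx₀)
      have h3 := (hub x₀ hx₀ g).isSelfAdjoint.sub (entry_nonneg h2 g⁻¹).isSelfAdjoint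
      rwa [entry_sub, sub_sub_sub_cancel_right] at h3
    · intro v
      have h2 := re_inner_le_of_isLUB (isVonNeumann_crossedProduct N α) hne hdir ha
        (v := single g⁻¹ v) (c := (⟪v, (α g n : H →L[ℂ] H) v⟫_ℂ).re) fun x hx => by
          have h3 := (nonneg_iff_re_inner.1 (hub x hx g)).2 v
          rw [sub_apply, inner_sub_right, Complex.sub_re, inner_entry] at h3
          linarith
      rw [sub_apply, inner_sub_right, Complex.sub_re, inner_entry]
      linarith
  rw [map_sub] at hkey
  exact sub_nonneg.1 hkey

theorem isFaithfulNormalCondExp_condExp :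
    IsFaithfulNormalCondExp (copyOfAlgebra_le N α) (condExp N α) where
  apply_of_mem := by
    rintro ⟨_, x, rfl⟩
    refine Subtype.ext (congrArg (rep N α) (Subtype.ext ?_))
    change entry (rep N α x) 1 1 = x
    rw [entry_rep_self, inv_one, map_one]
    rfl
  bimodule := by
    rintro ⟨_, x, rfl⟩ ⟨_, y, rfl⟩ m
    refine Subtype.ext ?_
    change rep N α _ = rep N α x * rep N α _ * rep N α y
    rw [← map_mul, ← map_mul]
    refine congrArg (rep N α) (Subtype.ext (ContinuousLinearMap.ext fun v => ?_))
    change (rep N α x (m.1 (rep N α y (single 1 v)))) 1 = _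
    rw [rep_apply, rep_single, inv_one, map_one]
    rfl
  positive _ hm := condExp_nonneg N α hm
  faithful m hm := by
    have h0 : coefficient N α (star m * m) = 0 := by
      refine rep_injective N α ?_
      rw [map_zero]
      exact congrArg Subtype.val hm
    refine Subtype.ext (ext_single fun g v => ?_)
    have h1 := entry_self N α (star m * m) g
    rw [h0, map_zero] at h1
    have h2 := inner_entry (star m * m).1 g g v v
    rw [h1] at h2
    change ⟪v, (0 : H →L[ℂ] H) v⟫_ℂ = ⟪single g v, star m.1 (m.1 (single g v))⟫_ℂ at h2
    rw [ContinuousLinearMap.star_eq_adjoint, ContinuousLinearMap.adjoint_inner_right, zero_apply,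
      inner_zero_right] at h2
    exact inner_self_eq_zero.1 h2.symm
  normal := scottContinuous_condExp N α

end CondExp

/-! ### Density in the ultraweak topology -/

section Density

variable {K : Type*} [NormedAddCommGroup K] [InnerProductSpace ℂ K]

/-- Restriction of square-summable families along an injective map of index sets. -/
def restrict {J J' : Type*} (f : J' ↪ J) : ell2 J K →L[ℂ] ell2 J' K :=
  have hf (w : ell2 J K) : Memℓp (fun j => w (f j)) 2 :=
    (memℓp_gen_iff (by norm_num)).2
      (((memℓp_gen_iff (by norm_num)).1 (lp.memℓp w)).comp_injective f.injective)
  LinearMap.mkContinuous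
    { toFun := fun w => (⟨fun j => w (f j), hf w⟩ : ell2 J' K)
      map_add' := fun _ _ => rfl
      map_smul' := fun _ _ => rfl } 1 fun w => by
    rw [one_mul]
    refine lp.norm_le_of_forall_sum_le (by norm_num) (norm_nonneg _) fun s => ?_
    have := lp.sum_rpow_le_norm_rpow (p := 2) (by norm_num) w (s.map f)
    rwa [Finset.sum_map] at this

/-- The linear map `T ↦ (1 ⊗ T) x`. -/
def amplifyAt {J : Type*} (x : ell2 J K) : (K →L[ℂ] K) →ₗ[ℂ] ell2 J K where
  toFun T := amplify J T x
  map_add' _ _ := lp.ext (funext fun _ => rfl)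
  map_smul' _ _ := lp.ext (funext fun _ => rfl)

theorem ultraweakTopology_eq_induced : ultraweakTopology K =
    TopologicalSpace.induced
      (fun (T : K →L[ℂ] K) (p : lp (fun _ : ℕ => K) 2 × lp (fun _ : ℕ => K) 2) =>
        ∑' n, ⟪p.1 n, T (p.2 n)⟫_ℂ) Pi.topologicalSpace := by
  rw [Pi.topologicalSpace, induced_iInf, iInf_prod]
  simp only [induced_compose]
  rfl

variable [CompleteSpace K]

theorem star_amplify (J : Type*) (y : K →L[ℂ] K) : star (amplify J y) = amplify J (star y) := by
  rw [ContinuousLinearMap.star_eq_adjoint, eq_comm, ContinuousLinearMap.eq_adjoint_iff]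
  intro ξ η
  simp only [lp.inner_eq_tsum, amplify_apply, ContinuousLinearMap.star_eq_adjoint,
    ContinuousLinearMap.adjoint_inner_left]

theorem mul_starProjection_comm {L : Submodule ℂ K} [L.HasOrthogonalProjection] {T : K →L[ℂ] K}
    (hT : ∀ v ∈ L, T v ∈ L) (hT' : ∀ v ∈ L, (star T) v ∈ L) :
    T * L.starProjection = L.starProjection * T := by
  have h : ∀ S : K →L[ℂ] K, (∀ v ∈ L, S v ∈ L) →
      L.starProjection * (S * L.starProjection) = S * L.starProjection := fun S hS =>
    ContinuousLinearMap.ext fun v => Submodule.starProjection_eq_self_iff.2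
      (hS _ (Submodule.starProjection_apply_mem L v))
  have hsa : star L.starProjection = L.starProjection :=
    isStarProjection_starProjection.isSelfAdjoint
  have h2 := congrArg star (h _ hT')
  simp only [star_mul, star_star, hsa] at h2
  rw [← h2, mul_assoc, h T hT]

/-- The density theorem at a single vector of an amplification: the projection onto the closure of
`(1 ⊗ W) x` commutes with the amplified generators, so its entries lie in their commutant and it
commutes with `1 ⊗ m`. -/
theorem amplify_mem_closure {S : Set (K →L[ℂ] K)} {W : Submodule ℂ (K →L[ℂ] K)} (h1 : 1 ∈ W)
    (hS : ∀ s ∈ S, ∀ w ∈ W, s * w ∈ W ∧ star s * w ∈ W) {m : K →L[ℂ] K} (hm : m ∈ generatedVN S)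
    {J : Type*} (x : ell2 J K) :
    amplify J m x ∈ closure ((fun w => amplify J w x) '' (W : Set (K →L[ℂ] K))) := by
  set L : Submodule ℂ (ell2 J K) := (W.map (amplifyAt x)).topologicalClosure with hL
  have hinv : ∀ s : K →L[ℂ] K, (∀ w ∈ W, s * w ∈ W) → ∀ v ∈ L, amplify J s v ∈ L := by
    intro s hs
    refine closure_invariant ?_
    rintro _ ⟨w, hw, rfl⟩
    exact ⟨s * w, hs w hw, lp.ext (funext fun j => rfl)⟩
  have hcomm : ∀ s ∈ S, (L.starProjection * amplify J s = amplify J s * L.starProjection) ∧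
      (L.starProjection * amplify J (star s) = amplify J (star s) * L.starProjection) := by
    intro s hs
    have e1 := hinv s fun w hw => (hS s hs w hw).1
    have e2 := hinv (star s) fun w hw => (hS s hs w hw).2
    constructor
    · exact (mul_starProjection_comm e1 (by rwa [star_amplify])).symm
    · exact (mul_starProjection_comm e2 (by rwa [star_amplify, star_star])).symm
  have hPm : L.starProjection * amplify J m = amplify J m * L.starProjection := by
    refine amplify_commute_iff.2 fun g h => ?_
    refine ((StarSubalgebra.mem_centralizer_iff ℂ).1 hm _ ?_).1
    refine (StarSubalgebra.mem_centralizer_iff ℂ).2 fun s hs => ?_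
    exact ⟨(amplify_commute_iff.1 (hcomm s hs).1 g h).symm,
      (amplify_commute_iff.1 (hcomm s hs).2 g h).symm⟩
  have hx : x ∈ L := Submodule.le_topologicalClosure _ ⟨1, h1, lp.ext (funext fun j => rfl)⟩
  have h2 := DFunLike.congr_fun hPm x
  rw [mul_apply_eq_comp, mul_apply_eq_comp, Submodule.starProjection_eq_self_iff.2 hx] at h2
  exact Submodule.starProjection_eq_self_iff.1 h2

/-- Von Neumann's density theorem for the ultraweak topology. It is stated for a subspace `W` that
contains `1` and is a left module over the generators `S` and their adjoints. -/
theorem generatedVN_subset_closure {S : Set (K →L[ℂ] K)} {W : Submodule ℂ (K →L[ℂ] K)}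
    (h1 : 1 ∈ W) (hS : ∀ s ∈ S, ∀ w ∈ W, s * w ∈ W ∧ star s * w ∈ W) :
    (generatedVN S : Set (K →L[ℂ] K)) ⊆ @closure _ (ultraweakTopology K) (W : Set (K →L[ℂ] K)) := by
  intro m hm
  rw [ultraweakTopology_eq_induced, closure_induced, mem_closure_iff]
  intro o ho hmo
  obtain ⟨I, u, hu, hsub⟩ := isOpen_pi_iff.1 ho _ hmo
  -- collect the finitely many sequences `η` of a basic neighborhood into one vector of an amplification
  let x : ell2 (I × ℕ) K := ⟨fun j => j.1.1.2 j.2, by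
    refine (memℓp_gen_iff (by norm_num)).2 ((summable_prod_of_nonneg fun j => by positivity).2
      ⟨fun i => (memℓp_gen_iff (by norm_num)).1 (lp.memℓp i.1.2), Summable.of_finite⟩)⟩
  let emb (i : I) : ℕ ↪ I × ℕ := ⟨fun n => (i, n), fun _ _ h => (Prod.ext_iff.1 h).2⟩
  set V : Set (ell2 (I × ℕ) K) := ⋂ i : I, (fun y => ⟪i.1.1, restrict (emb i) y⟫_ℂ) ⁻¹' u i with hV
  have hVo : IsOpen V := isOpen_iInter_of_finite fun i =>
    (hu i i.2).1.preimage (by fun_prop)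
  have hval : ∀ (T : K →L[ℂ] K) (i : I), ⟪i.1.1, restrict (emb i) (amplify (I × ℕ) T x)⟫_ℂ =
      ∑' n, ⟪i.1.1 n, T (i.1.2 n)⟫_ℂ := fun T i => lp.inner_eq_tsum _ _
  have hmV : amplify (I × ℕ) m x ∈ V := Set.mem_iInter.2 fun i => by
    change ⟪i.1.1, restrict (emb i) (amplify (I × ℕ) m x)⟫_ℂ ∈ u i
    rw [hval]
    exact (hu i i.2).2
  obtain ⟨_, hyV, w, hw, rfl⟩ := mem_closure_iff.1 (amplify_mem_closure h1 hS hm x) V hVo hmV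
  refine ⟨_, hsub fun i hi => ?_, w, hw, rfl⟩
  have h3 := Set.mem_iInter.1 hyV ⟨i, hi⟩
  change ⟪i.1, restrict (emb ⟨i, hi⟩) (amplify (I × ℕ) w x)⟫_ℂ ∈ u i at h3
  rw [hval w ⟨i, hi⟩] at h3
  exact h3

end Density

/-! ### Regularity of the center -/

section Regularity

variable {H : Type*} [NormedAddCommGroup H] [InnerProductSpace ℂ H] [CompleteSpace H]
  {G : Type*} [Group G] (N : VonNeumannAlgebra H)
  (α : G →* (N.toStarSubalgebra ≃⋆ₐ[ℂ] N.toStarSubalgebra))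

theorem span_unitary_eq_top :
    Submodule.span ℂ (unitary N.toStarSubalgebra : Set N.toStarSubalgebra) = ⊤ := by
  have hc : IsClosed (N.toStarSubalgebra : Set (H →L[ℂ] H)) := by
    rw [VonNeumannAlgebra.coe_toStarSubalgebra, ← N.centralizer_centralizer]
    exact Set.isClosed_centralizer _
  let _ : CStarAlgebra N.toStarSubalgebra := StarSubalgebra.cstarAlgebra _ (h_closed := hc)
  exact CStarAlgebra.span_unitary N.toStarSubalgebra

theorem rep_unitary_mul_translation_mem {u : N.toStarSubalgebra}
    (hu : u ∈ unitary N.toStarSubalgebra) (g : G) : rep N α u * translation g ∈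
      groupoidNormalizer (crossedProduct N α) (copyOfCenter N α) := by
  have hu1 : star u * u = 1 := (Unitary.mem_iff.1 hu).1
  have hu2 : u * star u = 1 := (Unitary.mem_iff.1 hu).2
  have htt : (translation g : ell2 G H →L[ℂ] ell2 G H) * translation g⁻¹ = 1 := by
    rw [← translation_mul, mul_inv_cancel, translation_one]
  have hstar : star (rep N α u * translation g) = translation g⁻¹ * rep N α (star u) := by
    rw [star_mul, star_translation, map_star]
  refine ⟨mul_mem (rep_mem N α u) (translation_mem N α g), ?_, ?_⟩
  · rw [hstar, mul_assoc (rep N α u), ← mul_assoc (translation g), htt, one_mul, ← map_mul, hu2,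
      map_one, one_mul]
  · rintro _ ⟨d, hd, rfl⟩
    have hd' := mem_center_iff.1 hd
    change star _ * rep N α d * _ ∈ _ ∧ _ * rep N α d * star _ ∈ _
    rw [hstar]
    constructor
    · refine ⟨α g⁻¹ d, map_mem_center _ hd, ?_⟩
      change rep N α (α g⁻¹ d) = _
      have h3 : translation g⁻¹ * rep N α (star u) * rep N α d * (rep N α u * translation g) =
          translation g⁻¹ * rep N α (star u * d * u) * translation g := by
        rw [map_mul, map_mul]
        simp only [mul_assoc]
      rw [h3, hd', mul_assoc d, hu1, mul_one, translation_mul_rep, mul_assoc, ← translation_mul,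
        inv_mul_cancel, translation_one, mul_one]
    · refine ⟨α g d, map_mem_center _ hd, ?_⟩
      change rep N α (α g d) = _
      rw [mul_assoc (rep N α u), translation_mul_rep, mul_assoc, mul_assoc,
        ← mul_assoc _ _ (rep N α (star u)), htt, one_mul, ← map_mul, ← map_mul,
        mem_center_iff.1 (map_mem_center (α g) hd) (star u) |>.symm, ← mul_assoc, hu2, one_mul]

theorem isRegular_copyOfCenter : IsRegular (crossedProduct N α) (copyOfCenter N α) := by
  set W := Submodule.span ℂ (Set.range fun p : N.toStarSubalgebra × G =>
    rep N α p.1 * translation p.2) with hW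
  have hgen : ∀ x g, rep N α x * translation g ∈ W := fun x g =>
    Submodule.subset_span ⟨(x, g), rfl⟩
  have hmul : ∀ T : ell2 G H →L[ℂ] ell2 G H,
      (∀ x g, T * (rep N α x * translation g) ∈ W) → ∀ w ∈ W, T * w ∈ W := by
    intro T hT
    have : W ≤ W.comap (LinearMap.mulLeft ℂ T) := by
      refine Submodule.span_le.2 ?_
      rintro _ ⟨p, rfl⟩
      exact hT p.1 p.2
    exact this
  have hrep : ∀ x, ∀ w ∈ W, rep N α x * w ∈ W := fun x => hmul _ fun y g => by
    rw [← mul_assoc, ← map_mul]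
    exact hgen _ _
  have htr : ∀ g, ∀ w ∈ W, translation g * w ∈ W := fun g => hmul _ fun y h => by
    rw [← mul_assoc, translation_mul_rep, mul_assoc, ← translation_mul]
    exact hgen _ _
  have h1 : 1 ∈ W := by
    have := hgen 1 1
    rwa [map_one, translation_one, mul_one] at this
  have hWN : W ≤ Submodule.span ℂ (groupoidNormalizer (crossedProduct N α) (copyOfCenter N α)) := by
    refine Submodule.span_le.2 ?_
    rintro _ ⟨⟨x, g⟩, rfl⟩
    have hx : x ∈ Submodule.span ℂ (unitary N.toStarSubalgebra : Set N.toStarSubalgebra) := by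
      rw [span_unitary_eq_top]
      trivial
    have := Submodule.mem_map_of_mem
      (f := LinearMap.mulRight ℂ (translation g) ∘ₗ (rep N α).toAlgHom.toLinearMap) hx
    rw [Submodule.map_span] at this
    refine Submodule.span_mono ?_ this
    rintro _ ⟨u, hu, rfl⟩
    exact rep_unitary_mul_translation_mem N α hu g
  refine (generatedVN_subset_closure h1 ?_).trans (@closure_mono _ (ultraweakTopology _) _ _ hWN)
  rintro _ (⟨x, rfl⟩ | ⟨g, rfl⟩) w hw
  · exact ⟨hrep x w hw, by rw [← map_star]; exact hrep _ w hw⟩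
  · exact ⟨htr g w hw, by rw [star_translation]; exact htr _ w hw⟩

end Regularity

end CartanTriple

end

open CartanTriple in
theorem theorem6p3 {H : Type*} [NormedAddCommGroup H] [InnerProductSpace ℂ H] [CompleteSpace H]
    {G : Type*} [Group G] (N : VonNeumannAlgebra H)
    (α : G →* (N.toStarSubalgebra ≃⋆ₐ[ℂ] N.toStarSubalgebra))
    (hα : ∀ g : G, g ≠ 1 → IsProperlyOuter (α g)) :
    IsCartanTriple (crossedProduct N α) (copyOfAlgebra N α) (copyOfCenter N α) ↔
      ∀ g : G, g ≠ 1 → IsProperlyOuter (restrictCenter (α g)) := by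
  constructor
  · intro h g hg
    exact isProperlyOuter_restrictCenter N α
      (fun m hm hc => (h.relativeCommutant m).2 ⟨hm, hc⟩) hg
  · intro h
    have hvN := isVonNeumann_copyOfAlgebra N α h
    exact
      { vonNeumann_M := isVonNeumann_crossedProduct N α
        vonNeumann_N := hvN
        vonNeumann_D := isVonNeumann_copyOfCenter N α hvN
        le := (copyOfCenter_le N α).trans (copyOfAlgebra_le N α)
        abelian := fun x hx y hy =>
          ((mem_copyOfAlgebra_iff_commute N α h y).1 (copyOfCenter_le N α hy)).2 x hx
        regular := isRegular_copyOfCenter N α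
        relativeCommutant := mem_copyOfAlgebra_iff_commute N α h
        condExp := ⟨copyOfAlgebra_le N α, condExp N α, isFaithfulNormalCondExp_condExp N α⟩ }
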